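/- **Conventions.** A second-order signature is a set of operators, each with an arity $(n_1,\dots,n_k)\in\mathbb N^*$; an operator of this arity takes $k$ arguments and binds $n_i$ variables in the $i$-th one. Terms in context $\mathsf m_1:[m_1],\dots,\mathsf m_k:[m_k]\rhd x_1,\dots,x_n\vdash t$ are built, up to $\alpha$-equivalence, from the variables $x_j$, the metavariables, as $\mathsf m_i[t_1,\dots,t_{m_i}]$, and the operators, as $\omega((\vec y_1)t_1,\dots,(\vec y_l)t_l)$. A term is elementary if it contains no operator. Substitution $t\{x_i:=s_i\}$ of terms for variables is capture-avoiding, and metasubstitution $t\{\mathsf m_i:=(\vec x_i)t_i\}$ of abstracted terms for metavariables is determined by $\mathsf m_l[s_1,\dots,s_{m_l}]\{\mathsf m_i:=(\vec x_i)t_i\}=t_l\{x^{(l)}_j:=s_j\{\mathsf m_i:=(\vec x_i)t_i\}\}$ and by commutation with variables and operators. A second-order equational presentation $\mathcal E$ is a signature together with a set of axioms $\Theta\rhd\Gamma\vdash s\equiv t$. Second-order equational logic derives equations from the axioms by reflexivity, symmetry, transitivity and extended metasubstitution: from $\mathsf m_1:[m_1],\dots,\mathsf m_k:[m_k]\rhd\Gamma\vdash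 s\equiv t$ and $\Theta\rhd\Delta,\vec x_i\vdash s_i\equiv t_i$ ($1\le i\le k$) infer $\Theta\rhd\Gamma,\Delta\vdash s\{\mathsf m_i:=(\vec x_i)s_i\}\equiv t\{\mathsf m_i:=(\vec x_i)t_i\}$. The category $\mathbf M$ has object set $\mathbb N^*$. Its morphisms $(m_1,\dots,m_k)\to(n_1,\dots,n_l)$ are the tuples $\langle \mathsf m_1:[m_1],\dots,\mathsf m_k:[m_k]\rhd x_1,\dots,x_{n_i}\vdash t_i\rangle_{1\le i\le l}$ of elementary terms. Its identities are $\langle\mathsf m_i[\vec x]\rangle_i$, and $\langle t_q\rangle_q\circ\langle s_p\rangle_p=\langle t_q\{\mathsf m_p:=(\vec x)s_p\}\rangle_q$. Its terminal object is $()$, binary products are given by concatenation with projections $\langle\mathsf m_i[\vec x]\rangle_i$, and the object $(0)$ is exponentiable, with $(0)\Rightarrow(m_1,\dots,m_k)=(m_1+1,\dots,m_k+1)$ and evaluation $\langle \mathsf m_i[x_1,\dots,x_{m_i},\mathsf n[]]\rangle_i:((0)\Rightarrow(m_1,\dots,m_k))\times(0)\to(m_1,\dots,m_k)$, where $\mathsf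 n:[0]$ is the last metavariable. A second-order algebraic theory is a small cartesian category $\mathcal M$ together with a strict cartesian identity-on-objects functor $M:\mathbf M\to\mathcal M$ that preserves the exponentiable object $(0)$, that is, $(0)\Rightarrow\Theta$ with the image under $M$ of the evaluation is an exponential of $\Theta$ by $(0)$ in $\mathcal M$, for every $\Theta\in\mathbb N^*$. A morphism (algebraic translation) from $M:\mathbf M\to\mathcal M$ to $M':\mathbf M\to\mathcal M'$ is a cartesian functor $F:\mathcal M\to\mathcal M'$ with $F\circ M=M'$. The classifying theory of a presentation $\mathcal E$ is the second-order algebraic theory $M_{\mathcal E}:\mathbf M\to\mathbf M(\mathcal E)$, where $\mathbf M(\mathcal E)$ is defined like $\mathbf M$ but with tuples of classes $[t]_{\mathcal E}$ of arbitrary terms over the signature of $\mathcal E$ modulo derivable equality, and $M_{\mathcal E}\langle t_i\rangle_i=\langle[t_i]_{\mathcal E}\rangle_i$. The internal language $\mathrm{IL}(M)$ of a second-order algebraic theory $M:\mathbf M\to\mathcal M$ is the presentation that has an operator $\omega_f$ of arity $(m_1,\dots,m_k,0^n)$ (ending in $n$ zeros) for every morphism $f:(m_1,\dots,m_k)\to(n)$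 of $\mathcal M$, and the following axioms, in which $$\mathsf t_f=\omega_f\big((\vec x_1)\mathsf m_1[\vec x_1],\dots,(\vec x_k)\mathsf m_k[\vec x_k],x_1,\dots,x_n\big).$$ * (E1) $\mathsf m_1:[m_1],\dots,\mathsf m_k:[m_k]\rhd x_1,\dots,x_n\vdash s\equiv \mathsf t_{M\langle s\rangle}$ for every morphism $\langle s\rangle:(m_1,\dots,m_k)\to(n)$ of $\mathbf M$. * (E2) $\mathsf m_1:[m_1],\dots,\mathsf m_k:[m_k]\rhd x_1,\dots,x_n\vdash \mathsf t_h\equiv\mathsf t_g\{\mathsf m_i:=(\vec x_i)\mathsf t_{f_i}\}_{1\le i\le l}$ for all morphisms $h:(m_1,\dots,m_k)\to(n)$, $g:(n_1,\dots,n_l)\to(n)$ and $f_i:(m_1,\dots,m_k)\to(n_i)$ ($1\le i\le l$) of $\mathcal M$ with $h=g\circ\langle f_1,\dots,f_l\rangle$. **Theorem (Theory/presentation correspondence).** Every second-order algebraic theory $M:\mathbf M\to\mathcal M$ is isomorphic, in the category of second-order algebraic theories and algebraic translations, to the classifying theory $M_{\mathrm{IL}(M)}:\mathbf M\to\mathbf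 M(\mathrm{IL}(M))$ of its internal language. -/

import Mathlib

open CategoryTheory CategoryTheory.Limits

universe v

namespace SecondOrder

/-! ## Contexts and second-order terms -/

/-- `Position m Θ` is the type of positions of the list `Θ` at which the entry is `m`.
When `Θ = (m₁, …, mₖ)` is read as the metavariable context `M₁ : [m₁], …, Mₖ : [mₖ]`, it is the
type of metavariables of meta-arity `m` declared in `Θ`. -/
inductive Position : ℕ → List ℕ → Type
  | head {m : ℕ} {Θ : List ℕ} : Position m (m :: Θ)
  | tail {m k : ℕ} {Θ : List ℕ} : Position m Θ → Position m (k :: Θ)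

namespace Position

/-- A position of `Θ`, as a position of `Θ ++ Θ'`. -/
def inl {m : ℕ} {Θ : List ℕ} (Θ' : List ℕ) : Position m Θ → Position m (Θ ++ Θ')
  | head => head
  | tail p => tail (p.inl Θ')

/-- A position of `Θ'`, as a position of `Θ ++ Θ'`. -/
def inr {m : ℕ} : (Θ : List ℕ) → {Θ' : List ℕ} → Position m Θ' → Position m (Θ ++ Θ')
  | [], _, p => p
  | _ :: Θ, _, p => tail (inr Θ p)

/-- Definition by cases on a position of `Θ ++ Θ'`. -/
def elim {m : ℕ} {α : Sort*} : {Θ Θ' : List ℕ} → (Position m Θ → α) → (Position m Θ' → α) →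
    Position m (Θ ++ Θ') → α
  | [], _, _, g, p => g p
  | _ :: _, _, f, _, head => f head
  | _ :: _, _, f, g, tail p => elim (fun q => f (tail q)) g p

/-- The position of `(m₁ + 1, …, mₖ + 1)` corresponding to a position of `(m₁, …, mₖ)`. -/
def succ {m : ℕ} {Θ : List ℕ} : Position m Θ → Position (m + 1) (Θ.map (· + 1))
  | head => head
  | tail p => tail p.succ

/-- The index of a position. -/
def index {m : ℕ} {Θ : List ℕ} : Position m Θ → Fin Θ.length
  | head => ⟨0, Nat.succ_pos _⟩
  | tail p => p.index.succ

theorem elim_inl {m : ℕ} {α : Sort*} {Θ Θ' : List ℕ} (f : Position m Θ → α)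
    (g : Position m Θ' → α) (p : Position m Θ) : elim f g (p.inl Θ') = f p := by
  induction p with
  | head => rfl
  | tail p ih => exact ih (fun q => f (tail q))

theorem elim_inr {m : ℕ} {α : Sort*} {Θ Θ' : List ℕ} (f : Position m Θ → α)
    (g : Position m Θ' → α) (p : Position m Θ') : elim f g (p.inr Θ) = g p := by
  induction Θ with
  | nil => rfl
  | cons a Θ ih => exact ih (fun q => f (tail q))

theorem inl_or_inr {m : ℕ} {Θ Θ' : List ℕ} (p : Position m (Θ ++ Θ')) :
    (∃ q, p = inl Θ' q) ∨ (∃ q, p = inr Θ q) := by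
  induction Θ with
  | nil => exact Or.inr ⟨p, rfl⟩
  | cons a Θ ih =>
    cases p with
    | head => exact Or.inl ⟨head, rfl⟩
    | tail p =>
      rcases ih p with ⟨q, rfl⟩ | ⟨q, rfl⟩
      · exact Or.inl ⟨tail q, rfl⟩
      · exact Or.inr ⟨q, rfl⟩

/-- Definition by cases on a position of `k :: Θ`. -/
def cases {α : ℕ → Sort*} {k : ℕ} {Θ : List ℕ} (x : α k) (f : ∀ m, Position m Θ → α m) :
    ∀ m, Position m (k :: Θ) → α m
  | _, head => x
  | _, tail p => f _ p

/-- Definition by cases on a position of `(m₁ + 1, …, mₖ + 1)`. -/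
def unsucc {α : ℕ → Sort*} : {Θ : List ℕ} → (∀ m, Position m Θ → α (m + 1)) →
    ∀ m, Position m (Θ.map (· + 1)) → α m
  | [], _ => fun _ p => nomatch p
  | a :: _, f => cases (f a head) (unsucc fun m q => f m (tail q))

theorem unsucc_succ {Θ : List ℕ} {α : ℕ → Sort*} (f : ∀ m, Position m Θ → α (m + 1))
    {m : ℕ} (p : Position m Θ) : unsucc f _ p.succ = f m p := by
  induction p with
  | head => rfl
  | tail p ih => exact ih (fun m q => f m (tail q))

theorem succ_cases {Θ : List ℕ} {P : ∀ m, Position m (Θ.map (· + 1)) → Prop}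
    (h : ∀ m (q : Position m Θ), P (m + 1) q.succ) : ∀ m p, P m p := by
  induction Θ with
  | nil => exact fun _ p => nomatch p
  | cons a Θ ih =>
    intro m p
    cases p with
    | head => exact h a head
    | tail p => exact ih (P := fun m p => P m (tail p)) (fun m q => h m (tail q)) m p

end Position

/-- A (mono-sorted) second-order signature: operators with arities in `ℕ*`.  An operator of arity
`(n₁, …, nₖ)` takes `k` arguments and binds `nᵢ` variables in the `i`-th one. -/
structure Signature where
  Op : Type v
  arity : Op → List ℕ

/-- The signature without operators. -/
def emptySignature : Signature.{0} := ⟨Empty, fun ω => nomatch ω⟩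

/-- Second-order terms `Θ ▹ x₁, …, xₙ ⊢ t` over `S`, up to α-equivalence: variables are
represented by their position (in `Fin n`) in the variable context, and an operator that binds
`m` variables in an argument extends the variable context `n` to `n + m` by appending them. -/
inductive Term (S : Signature.{v}) (Θ : List ℕ) : ℕ → Type v
  | var {n : ℕ} (x : Fin n) : Term S Θ n
  | mvar {n m : ℕ} (i : Position m Θ) (t : Fin m → Term S Θ n) : Term S Θ n
  | op {n : ℕ} (ω : S.Op) (t : ∀ m, Position m (S.arity ω) → Term S Θ (n + m)) : Term S Θ n

/-- Extension of a renaming to `k` further (bound) variables. -/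
def liftRen {n n' : ℕ} (ρ : Fin n → Fin n') (k : ℕ) : Fin (n + k) → Fin (n' + k) :=
  Fin.addCases (fun x => Fin.castAdd k (ρ x)) (fun y => Fin.natAdd n' y)

namespace Term

variable {S : Signature.{v}} {Θ Θ' Θ'' : List ℕ}

/-- Capture-avoiding renaming of variables. -/
def rename {n n' : ℕ} (ρ : Fin n → Fin n') : Term S Θ n → Term S Θ n'
  | var x => var (ρ x)
  | mvar i t => mvar i fun j => (t j).rename ρ
  | op ω t => op ω fun m i => (t m i).rename (liftRen ρ m)

/-- Extension of a substitution to `k` further (bound) variables, which it leaves fixed. -/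
def liftSub {n n' : ℕ} (σ : Fin n → Term S Θ n') (k : ℕ) : Fin (n + k) → Term S Θ (n' + k) :=
  Fin.addCases (fun x => (σ x).rename (Fin.castAdd k)) (fun y => var (Fin.natAdd n' y))

/-- Capture-avoiding simultaneous substitution `t {xᵢ := σᵢ}` of terms for variables. -/
def subst {n n' : ℕ} (σ : Fin n → Term S Θ n') : Term S Θ n → Term S Θ n'
  | var x => σ x
  | mvar i t => mvar i fun j => (t j).subst σ
  | op ω t => op ω fun m i => (t m i).subst (liftSub σ m)

/-- Metasubstitution `t {Mᵢ := (x⃗ᵢ) τᵢ}` of abstracted terms for metavariables, where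
`Θ ▹ Γ ⊢ t` and `Θ' ▹ Γ, x⃗ᵢ ⊢ τᵢ`, with result `Θ' ▹ Γ ⊢ t {Mᵢ := (x⃗ᵢ) τᵢ}`. -/
def msubst {n : ℕ} : Term S Θ n → (∀ m, Position m Θ → Term S Θ' (n + m)) → Term S Θ' n
  | var x, _ => var x
  | mvar (m := m) i t, τ => (τ m i).subst (Fin.addCases var fun j => (t j).msubst τ)
  | op ω t, τ => op ω fun k i =>
      (t k i).msubst fun m p => (τ m p).rename (liftRen (Fin.castAdd k) m)

/-- The metasubstitution `t {Mᵢ := (x⃗ᵢ) sᵢ}` for terms `Θ' ▹ x⃗ᵢ ⊢ sᵢ` that have no other variables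
than the abstracted ones; they are weakened to the variable context of `t`. -/
def inst {n : ℕ} (t : Term S Θ n) (s : ∀ m, Position m Θ → Term S Θ' m) : Term S Θ' n :=
  t.msubst fun m p => (s m p).rename (Fin.natAdd n)

/-- An elementary term (one built without operators) is a term over every signature. -/
def ofElementary {n : ℕ} : Term emptySignature Θ n → Term S Θ n
  | var x => var x
  | mvar i t => mvar i fun j => (t j).ofElementary
  | op ω _ => nomatch ω

/-! ### The substitution calculus -/

theorem liftRen_castAdd {n n' : ℕ} (ρ : Fin n → Fin n') (k : ℕ) (x : Fin n) :
    liftRen ρ k (Fin.castAdd k x) = Fin.castAdd k (ρ x) := by simp [liftRen]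

theorem liftRen_natAdd {n n' : ℕ} (ρ : Fin n → Fin n') (k : ℕ) (x : Fin k) :
    liftRen ρ k (Fin.natAdd n x) = Fin.natAdd n' x := by simp [liftRen]

theorem liftSub_castAdd {n n' : ℕ} (σ : Fin n → Term S Θ n') (k : ℕ) (x : Fin n) :
    liftSub σ k (Fin.castAdd k x) = (σ x).rename (Fin.castAdd k) := by simp [liftSub]

theorem liftSub_natAdd {n n' : ℕ} (σ : Fin n → Term S Θ n') (k : ℕ) (x : Fin k) :
    liftSub σ k (Fin.natAdd n x) = var (Fin.natAdd n' x) := by simp [liftSub]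

theorem addCases_ext {n k : ℕ} {α : Sort*} {f g : Fin (n + k) → α}
    (h₁ : ∀ x, f (Fin.castAdd k x) = g (Fin.castAdd k x))
    (h₂ : ∀ x, f (Fin.natAdd n x) = g (Fin.natAdd n x)) : f = g :=
  funext fun x => Fin.addCases (motive := fun x => f x = g x) h₁ h₂ x

theorem liftRen_id {n : ℕ} (k : ℕ) : liftRen (id : Fin n → Fin n) k = id :=
  addCases_ext (fun x => by simp [liftRen]) (fun x => by simp [liftRen])

theorem liftRen_comp {n n' n'' : ℕ} (ρ' : Fin n' → Fin n'') (ρ : Fin n → Fin n') (k : ℕ) :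
    liftRen ρ' k ∘ liftRen ρ k = liftRen (ρ' ∘ ρ) k :=
  addCases_ext (fun x => by simp [liftRen]) (fun x => by simp [liftRen])

theorem liftSub_var {n : ℕ} (k : ℕ) : liftSub (var : Fin n → Term S Θ n) k = var :=
  addCases_ext (fun x => by simp [liftSub, rename]) (fun x => by simp [liftSub])

theorem rename_id {n : ℕ} (t : Term S Θ n) : t.rename id = t := by
  induction t with
  | var x => rfl
  | mvar i t ih => simp [rename, ih]
  | op ω t ih => simp [rename, liftRen_id, ih]

theorem rename_rename {n n' n'' : ℕ} (t : Term S Θ n) (ρ : Fin n → Fin n') (ρ' : Fin n' → Fin n'') :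
    (t.rename ρ).rename ρ' = t.rename (ρ' ∘ ρ) := by
  induction t generalizing n' n'' with
  | var x => rfl
  | mvar i t ih => simp [rename, ih]
  | op ω t ih => simp [rename, ih, liftRen_comp]

theorem subst_var {n : ℕ} (t : Term S Θ n) : t.subst var = t := by
  induction t with
  | var x => rfl
  | mvar i t ih => simp [subst, ih]
  | op ω t ih => simp [subst, liftSub_var, ih]

theorem subst_rename {n n' n'' : ℕ} (t : Term S Θ n) (ρ : Fin n → Fin n')
    (σ : Fin n' → Term S Θ n'') : (t.rename ρ).subst σ = t.subst (σ ∘ ρ) := by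
  induction t generalizing n' n'' with
  | var x => rfl
  | mvar i t ih => simp [rename, subst, ih]
  | op ω t ih =>
    have h : ∀ k, liftSub σ k ∘ liftRen ρ k = liftSub (σ ∘ ρ) k := fun k =>
      addCases_ext (fun x => by simp [liftRen, liftSub]) (fun x => by simp [liftRen, liftSub])
    simp [rename, subst, ih, h]

theorem rename_subst {n n' n'' : ℕ} (t : Term S Θ n) (σ : Fin n → Term S Θ n')
    (ρ : Fin n' → Fin n'') : (t.subst σ).rename ρ = t.subst (fun x => (σ x).rename ρ) := by
  induction t generalizing n' n'' with
  | var x => rfl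
  | mvar i t ih => simp [rename, subst, ih]
  | op ω t ih =>
    have h : ∀ k, (fun x => (liftSub σ k x).rename (liftRen ρ k)) =
        liftSub (fun x => (σ x).rename ρ) k := fun k =>
      addCases_ext
        (fun x => by
          simp only [liftSub_castAdd, rename_rename]
          congr 1
          funext y
          simp [liftRen])
        (fun x => by simp [liftRen, liftSub, rename])
    simp [rename, subst, ih, h]

theorem subst_subst {n n' n'' : ℕ} (t : Term S Θ n) (σ : Fin n → Term S Θ n')
    (σ' : Fin n' → Term S Θ n'') : (t.subst σ).subst σ' = t.subst (fun x => (σ x).subst σ') := by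
  induction t generalizing n' n'' with
  | var x => rfl
  | mvar i t ih => simp [subst, ih]
  | op ω t ih =>
    have h : ∀ k, (fun x => (liftSub σ k x).subst (liftSub σ' k)) =
        liftSub (fun x => (σ x).subst σ') k := fun k =>
      addCases_ext
        (fun x => by
          simp only [liftSub_castAdd, subst_rename, rename_subst]
          congr 1
          funext y
          simp [liftSub])
        (fun x => by simp [liftSub, subst])
    simp [subst, ih, h]

theorem msubst_rename {n n' : ℕ} (t : Term S Θ n) (ρ : Fin n → Fin n')
    (τ : ∀ m, Position m Θ → Term S Θ' (n + m)) :
    (t.rename ρ).msubst (fun m p => (τ m p).rename (liftRen ρ m)) = (t.msubst τ).rename ρ := by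
  induction t generalizing n' with
  | var x => rfl
  | mvar i t ih =>
    simp only [rename, msubst, subst_rename, rename_subst, ih]
    congr 1
    exact addCases_ext (fun x => by simp [liftRen, rename]) (fun x => by simp [liftRen])
  | op ω t ih =>
    simp only [rename, msubst, ← ih, rename_rename]
    congr 1
    funext k i
    congr 1
    funext m p
    congr 1
    exact addCases_ext (fun x => by simp [liftRen]) (fun x => by simp [liftRen])

/-! Computation rules for `inst`. -/

theorem inst_var {n : ℕ} (x : Fin n) (s : ∀ m, Position m Θ → Term S Θ' m) :
    (var x : Term S Θ n).inst s = var x := rfl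

theorem inst_mvar {n m : ℕ} (i : Position m Θ) (t : Fin m → Term S Θ n)
    (s : ∀ m, Position m Θ → Term S Θ' m) :
    (mvar i t).inst s = (s m i).subst (fun j => (t j).inst s) := by
  simp only [inst, msubst, subst_rename]
  congr 1
  funext j
  simp

theorem inst_op {n : ℕ} (ω : S.Op) (t : ∀ m, Position m (S.arity ω) → Term S Θ (n + m))
    (s : ∀ m, Position m Θ → Term S Θ' m) :
    (op ω t).inst s = op ω (fun m i => (t m i).inst s) := by
  simp only [inst, msubst, rename_rename]
  congr 1
  funext k i
  congr 1
  funext m p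
  congr 1
  funext x
  simp [liftRen]

theorem inst_rename {n n' : ℕ} (t : Term S Θ n) (ρ : Fin n → Fin n')
    (s : ∀ m, Position m Θ → Term S Θ' m) : (t.rename ρ).inst s = (t.inst s).rename ρ := by
  rw [inst, inst, ← msubst_rename]
  congr 1
  funext m p
  rw [rename_rename]
  congr 1
  funext x
  simp [liftRen]

theorem inst_subst {n n' : ℕ} (t : Term S Θ n) (σ : Fin n → Term S Θ n')
    (s : ∀ m, Position m Θ → Term S Θ' m) :
    (t.subst σ).inst s = (t.inst s).subst (fun x => (σ x).inst s) := by
  induction t generalizing n' with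
  | var x => rfl
  | mvar i t ih => simp only [subst, inst_mvar, ih, subst_subst]
  | op ω t ih =>
    have h : ∀ k, (fun x => (liftSub σ k x).inst s) = liftSub (fun x => (σ x).inst s) k := fun k =>
      addCases_ext (fun x => by simp [liftSub, inst_rename])
        (fun x => by simp [liftSub, inst_var])
    simp only [subst, inst_op, ih, h]

theorem inst_inst {n : ℕ} (t : Term S Θ n) (s : ∀ m, Position m Θ → Term S Θ' m)
    (r : ∀ m, Position m Θ' → Term S Θ'' m) :
    (t.inst s).inst r = t.inst (fun m p => (s m p).inst r) := by
  induction t with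
  | var x => rfl
  | mvar i t ih => simp only [inst_mvar, inst_subst, ih]
  | op ω t ih => simp only [inst_op, ih]

theorem inst_id {n : ℕ} (t : Term S Θ n) : t.inst (fun _ p => mvar p var) = t := by
  induction t with
  | var x => rfl
  | mvar i t ih => simp only [inst_mvar, subst, ih]
  | op ω t ih => simp only [inst_op, ih]

theorem inst_msubst {n : ℕ} (t : Term S Θ n) (τ : ∀ m, Position m Θ → Term S Θ' (n + m))
    (s : ∀ m, Position m Θ' → Term S Θ'' m) :
    (t.msubst τ).inst s = t.msubst (fun m p => (τ m p).inst s) := by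
  induction t with
  | var x => rfl
  | mvar i t ih =>
    simp only [msubst, inst_subst]
    congr 1
    exact addCases_ext (fun x => by simp [inst_var]) (fun x => by simp [ih])
  | op ω t ih => simp only [msubst, inst_op, ih, inst_rename]

theorem msubst_rename_subst {n n' : ℕ} (t : Term S Θ n) (ρ : Fin n → Fin n')
    (τ : ∀ m, Position m Θ → Term S Θ' (n' + m)) (σ : Fin n' → Term S Θ' n)
    (h : ∀ x, σ (ρ x) = var x) :
    ((t.rename ρ).msubst τ).subst σ = t.msubst (fun m p => (τ m p).subst (liftSub σ m)) := by
  induction t generalizing n' with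
  | var x => exact h x
  | mvar i t ih =>
    simp only [rename, msubst, subst_subst]
    congr 1
    refine addCases_ext (fun x => ?_) (fun x => ?_)
    · simp only [Fin.addCases_left, subst, liftSub_castAdd, subst_rename]
      rw [← subst_var (σ x)]
      simp only [subst_subst]
      congr 1
      funext y
      simp [subst]
    · simp only [Fin.addCases_right, liftSub_natAdd, subst, ih _ ρ τ σ h]
  | op ω t ih =>
    simp only [rename, msubst, subst]
    congr 1
    funext k i
    rw [ih k i]
    · congr 1
      funext m p
      simp only [subst_rename, rename_subst]
      congr 1
      refine addCases_ext (fun x => ?_) (fun x => ?_)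
      · simp only [Function.comp, liftRen_castAdd, liftSub_castAdd, rename_rename]
        congr 1
        funext y
        simp [liftRen]
      · simp [liftRen, liftSub, rename]
    · exact fun x => Fin.addCases (motive := fun x => liftSub σ k (liftRen ρ k x) = var x)
        (fun x => by simp [liftRen, liftSub, h, rename]) (fun x => by simp [liftRen, liftSub]) x

theorem inst_inl_subst_msubst {N M : ℕ} (t : Term S Θ N) (σ : Fin N → Term S (Θ ++ Θ') M)
    (τ : ∀ m, Position m (Θ ++ Θ') → Term S Θ (M + m))
    (h : ∀ m (p : Position m Θ), τ m (p.inl Θ') = mvar p fun j => var (Fin.natAdd M j)) :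
    ((t.inst fun _ p => mvar (p.inl Θ') var).subst σ).msubst τ =
      t.subst fun x => (σ x).msubst τ := by
  induction t generalizing M with
  | var x => rfl
  | mvar i t ih => simp [inst_mvar, subst, msubst, h, ih _ σ τ h]
  | op ω t ih =>
    simp only [inst_op, subst, msubst]
    congr 1
    funext k i
    rw [ih k i _ _ (fun m p => by simp [h, rename, liftRen])]
    congr 1
    refine addCases_ext (fun x => ?_) (fun x => ?_)
    · simp only [liftSub_castAdd, msubst_rename]
    · simp [liftSub_natAdd, msubst]

theorem ofElementary_subst {n n' : ℕ} (t : Term emptySignature Θ n)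
    (σ : Fin n → Term emptySignature Θ n') :
    (t.subst σ).ofElementary = (t.ofElementary : Term S Θ n).subst fun x => (σ x).ofElementary := by
  induction t generalizing n' with
  | var x => rfl
  | mvar i t ih => simp only [subst, ofElementary, ih]
  | op ω t ih => exact nomatch ω

theorem ofElementary_inst {n : ℕ} (t : Term emptySignature Θ n)
    (s : ∀ m, Position m Θ → Term emptySignature Θ' m) :
    (t.inst s).ofElementary =
      (t.ofElementary : Term S Θ n).inst fun m p => (s m p).ofElementary := by
  induction t with
  | var x => rfl
  | mvar i t ih => simp only [inst_mvar, ofElementary, ofElementary_subst, ih]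
  | op ω t ih => exact nomatch ω

end Term

/-! ## Equational presentations and second-order equational logic -/

/-- A second-order equational presentation: a signature together with a set of axioms, each of
them a pair of terms in the same context. -/
structure Presentation where
  sig : Signature.{v}
  Eqn : ∀ {Θ : List ℕ} {n : ℕ}, Term sig Θ n → Term sig Θ n → Prop

/-- Second-order equational logic: `E.Derivable s t` says that `Θ ▹ Γ ⊢ s ≡ t` is derivable from
the axioms of `E` by the rules for equivalence and the rule of extended metasubstitution: from
`M₁ : [m₁], …, Mₖ : [mₖ] ▹ Γ ⊢ s ≡ t` and `Θ' ▹ Δ, x⃗ᵢ ⊢ uᵢ ≡ wᵢ` for `1 ≤ i ≤ k` infer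
`Θ' ▹ Γ, Δ ⊢ s {Mᵢ := (x⃗ᵢ) uᵢ} ≡ t {Mᵢ := (x⃗ᵢ) wᵢ}`.  Here `n` and `d` are the lengths of `Γ` and
`Δ`, and the renamings are the weakenings from `Γ` to `Γ, Δ` and from `Δ, x⃗ᵢ` to `Γ, Δ, x⃗ᵢ`. -/
inductive Presentation.Derivable (E : Presentation.{v}) :
    ∀ {Θ : List ℕ} {n : ℕ}, Term E.sig Θ n → Term E.sig Θ n → Prop
  | ax {Θ : List ℕ} {n : ℕ} {s t : Term E.sig Θ n} : E.Eqn s t → E.Derivable s t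
  | refl {Θ : List ℕ} {n : ℕ} (t : Term E.sig Θ n) : E.Derivable t t
  | symm {Θ : List ℕ} {n : ℕ} {s t : Term E.sig Θ n} : E.Derivable s t → E.Derivable t s
  | trans {Θ : List ℕ} {n : ℕ} {s t u : Term E.sig Θ n} :
      E.Derivable s t → E.Derivable t u → E.Derivable s u
  | msubst {Θ Θ' : List ℕ} {n d : ℕ} {s t : Term E.sig Θ n}
      {u w : ∀ m, Position m Θ → Term E.sig Θ' (d + m)} :
      E.Derivable s t → (∀ m i, E.Derivable (u m i) (w m i)) →
      E.Derivable
        ((s.rename (Fin.castAdd d)).msubst fun m i => (u m i).rename (liftRen (Fin.natAdd n) m))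
        ((t.rename (Fin.castAdd d)).msubst fun m i => (w m i).rename (liftRen (Fin.natAdd n) m))

namespace Presentation

variable (E : Presentation.{v})

/-- Provable equality in `E` of terms in a given context. -/
def setoid (Θ : List ℕ) (n : ℕ) : Setoid (Term E.sig Θ n) where
  r := E.Derivable
  iseqv := ⟨Derivable.refl, Derivable.symm, Derivable.trans⟩

/-- Equivalence classes `[Θ ▹ x₁, …, xₙ ⊢ t]_E` of terms modulo provable equality in `E`. -/
def Class (Θ : List ℕ) (n : ℕ) : Type v := Quotient (E.setoid Θ n)

variable {E}

/-- The equivalence class of a term. -/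
def cls {Θ : List ℕ} {n : ℕ} (t : Term E.sig Θ n) : E.Class Θ n := Quotient.mk (E.setoid Θ n) t

/-- A representative of an equivalence class. -/
noncomputable def rep {Θ : List ℕ} {n : ℕ} (t : E.Class Θ n) : Term E.sig Θ n := Quotient.out t

theorem cls_rep {Θ : List ℕ} {n : ℕ} (t : E.Class Θ n) : cls (rep t) = t := Quotient.out_eq t

theorem cls_eq_cls {Θ : List ℕ} {n : ℕ} {s t : Term E.sig Θ n} :
    cls s = cls t ↔ E.Derivable s t := Quotient.eq (r := E.setoid Θ n)

theorem rep_cls {Θ : List ℕ} {n : ℕ} (t : Term E.sig Θ n) : E.Derivable (rep (cls t)) t :=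
  cls_eq_cls.1 (cls_rep _)

theorem Derivable.cast {Θ : List ℕ} {n n' : ℕ} (h : n = n') {s t : Term E.sig Θ n}
    (hst : E.Derivable s t) : E.Derivable (s.rename (Fin.cast h)) (t.rename (Fin.cast h)) := by
  subst h
  have h' : Fin.cast (rfl : n = n) = id := rfl
  rwa [h', Term.rename_id, Term.rename_id]

theorem Derivable.inst {Θ Θ' : List ℕ} {n : ℕ} {s t : Term E.sig Θ n}
    {u w : ∀ m, Position m Θ → Term E.sig Θ' m} (hst : E.Derivable s t)
    (huw : ∀ m i, E.Derivable (u m i) (w m i)) : E.Derivable (s.inst u) (t.inst w) := by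
  have key : ∀ (s : Term E.sig Θ n) (u : ∀ m, Position m Θ → Term E.sig Θ' m),
      (s.rename (Fin.castAdd 0)).msubst (fun m i =>
        ((u m i).rename (Fin.cast (Nat.zero_add m).symm)).rename (liftRen (Fin.natAdd n) m)) =
      s.inst u := by
    intro s u
    have h' : (Fin.castAdd 0 : Fin n → Fin (n + 0)) = id := rfl
    rw [h', Term.rename_id, Term.inst]
    congr 1
    funext m i
    rw [Term.rename_rename]
    congr 1
    funext x
    have h'' : Fin.cast (Nat.zero_add m).symm x = Fin.natAdd 0 x := by ext; simp
    rw [Function.comp, h'', Term.liftRen_natAdd]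
    rfl
  have h := Derivable.msubst hst (fun m i => (huw m i).cast (Nat.zero_add m).symm)
  rwa [key, key] at h

end Presentation

/-! ## The second-order theory of equality -/

/-- The objects of the second-order theory of equality `𝕄`: finite sequences of naturals. -/
def EqTheory : Type := List ℕ

/-- Tuples of elementary terms `⟨M₁ : [m₁], …, Mₖ : [mₖ] ▹ x₁, …, x_{nᵢ} ⊢ tᵢ⟩`: the morphisms
`(m₁, …, mₖ) ⟶ (n₁, …, nₗ)` of `𝕄`. -/
abbrev ElementaryTuple (Θ Θ' : List ℕ) : Type := ∀ n, Position n Θ' → Term emptySignature Θ n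

/-- The category `𝕄`. The identity is `⟨Mᵢ[x⃗]⟩` and the composite of `⟨sₚ⟩` with `⟨t_q⟩` is
`⟨t_q {Mₚ := (x⃗) sₚ}⟩`. -/
instance : Category.{0} EqTheory where
  Hom Θ Θ' := ElementaryTuple Θ Θ'
  id _ := fun _ i => .mvar i .var
  comp s t := fun n q => (t n q).inst s
  id_comp t := by funext n q; exact Term.inst_id _
  comp_id s := by
    funext n q
    exact (Term.inst_mvar _ _ _).trans (Term.subst_var _)
  assoc r s t := by funext n q; exact (Term.inst_inst _ _ _).symm

namespace EqTheory

/-- A sequence of naturals as an object of `𝕄`. -/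
abbrev of (Θ : List ℕ) : EqTheory := Θ

/-- A single term `Θ ▹ x₁, …, xₙ ⊢ s` as a morphism `⟨s⟩ : Θ ⟶ (n)`. -/
def single {Θ : List ℕ} {n : ℕ} (s : Term emptySignature Θ n) : of Θ ⟶ of [n] :=
  fun _ p => match p with
    | .head => s

/-- The projection `⟨Θ ▹ x⃗ ⊢ Mᵢ[x⃗]⟩ : Θ ⟶ (m)` at a position `i` with entry `m`. -/
def proj {Θ : List ℕ} {m : ℕ} (i : Position m Θ) : of Θ ⟶ of [m] := single (.mvar i .var)

/-- The first projection of the product `Θ × Θ' = Θ ++ Θ'`. -/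
def fst (Θ Θ' : List ℕ) : of (Θ ++ Θ') ⟶ of Θ := fun _ i => .mvar (i.inl Θ') .var

/-- The second projection of the product `Θ × Θ' = Θ ++ Θ'`. -/
def snd (Θ Θ' : List ℕ) : of (Θ ++ Θ') ⟶ of Θ' := fun _ i => .mvar (i.inr Θ) .var

/-- The evaluation `⟨Mᵢ[x₁, …, x_{mᵢ}, N[]]⟩ : ((0) ⇒ Θ) × (0) ⟶ Θ`, where for
`Θ = (m₁, …, mₖ)` the exponential `(0) ⇒ Θ` is `(m₁ + 1, …, mₖ + 1)` and `N` is the last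
metavariable. -/
def ev (Θ : List ℕ) : of (Θ.map (· + 1) ++ [0]) ⟶ of Θ := fun m i =>
  .mvar (i.succ.inl [0]) (Fin.addCases (m := m) (n := 1) .var
    fun _ => .mvar (Position.inr (Θ.map (· + 1)) .head) Fin.elim0)

end EqTheory

/-! ## Second-order algebraic theories -/

/-- A small category with object set `ℕ*` together with an identity-on-objects functor from `𝕄`
to it. -/
structure IdOnObjects where
  cat : Category.{v} (List ℕ)
  map : ∀ {Θ Θ' : List ℕ}, (EqTheory.of Θ ⟶ EqTheory.of Θ') → cat.Hom Θ Θ'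
  map_id : ∀ Θ : List ℕ, map (𝟙 (EqTheory.of Θ)) = cat.id Θ
  map_comp : ∀ {Θ Θ' Θ'' : List ℕ} (s : EqTheory.of Θ ⟶ EqTheory.of Θ')
    (t : EqTheory.of Θ' ⟶ EqTheory.of Θ''), map (s ≫ t) = cat.comp (map s) (map t)

namespace IdOnObjects

/-- The objects of the category, i.e. finite sequences of naturals. -/
def Carrier (_T : IdOnObjects.{v}) : Type := List ℕ

instance (T : IdOnObjects.{v}) : Category.{v} T.Carrier := T.cat

/-- A sequence of naturals as an object of the category. -/
abbrev of (T : IdOnObjects.{v}) (Θ : List ℕ) : T.Carrier := Θ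

/-- The functor from `𝕄`, which is the identity on objects. -/
def functor (T : IdOnObjects.{v}) : EqTheory ⥤ T.Carrier where
  obj Θ := Θ
  map f := T.map f
  map_id Θ := T.map_id Θ
  map_comp s t := T.map_comp s t

/-- The image of the product cone `Θ ⟵ Θ × Θ' ⟶ Θ'` of `𝕄`. -/
abbrev productCone (T : IdOnObjects.{v}) (Θ Θ' : List ℕ) : BinaryFan (T.of Θ) (T.of Θ') :=
  BinaryFan.mk (P := T.of (Θ ++ Θ'))
    (T.functor.map (EqTheory.fst Θ Θ')) (T.functor.map (EqTheory.snd Θ Θ'))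

end IdOnObjects

/-- A second-order algebraic theory `M : 𝕄 ⟶ 𝓜`: a small cartesian category `𝓜` and a strict
cartesian identity-on-objects functor `M` from `𝕄` that preserves the exponentiable object `(0)`.
As `M` is strict and the identity on objects, the chosen terminal object of `𝓜` is the empty
sequence, and the chosen product of `Θ` and `Θ'` in `𝓜` is `Θ ++ Θ'` with the images under `M` of
the projections of `𝕄`.  Preservation of `(0)` says that every `M(ev) : ((0) ⇒ Θ) × (0) ⟶ Θ`
exhibits `(0) ⇒ Θ` as an exponential in `𝓜`; in particular `(0)` is exponentiable in `𝓜`. -/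
structure Theory extends IdOnObjects.{v} where
  isTerminal : IsTerminal (toIdOnObjects.of [])
  isProduct : ∀ Θ Θ' : List ℕ, IsLimit (toIdOnObjects.productCone Θ Θ')
  exists_unique_mate : ∀ (Ξ Θ : List ℕ)
    (f : toIdOnObjects.of (Ξ ++ [0]) ⟶ toIdOnObjects.of Θ),
    ∃! g : toIdOnObjects.of Ξ ⟶ toIdOnObjects.of (Θ.map (· + 1)),
      (isProduct (Θ.map (· + 1)) [0]).lift
          (BinaryFan.mk (P := toIdOnObjects.of (Ξ ++ [0]))
            (toIdOnObjects.functor.map (EqTheory.fst Ξ [0]) ≫ g)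
            (toIdOnObjects.functor.map (EqTheory.snd Ξ [0]))) ≫
        toIdOnObjects.functor.map (EqTheory.ev Θ) = f

/-- A second-order algebraic translation from `M : 𝕄 ⟶ 𝓜` to `M' : 𝕄 ⟶ 𝓜'`: a cartesian functor
`F : 𝓜 ⟶ 𝓜'` with `F ∘ M = M'`. -/
@[ext]
structure Translation (T T' : Theory.{v}) where
  functor : T.Carrier ⥤ T'.Carrier
  cartesian : PreservesFiniteProducts functor
  comm : T.functor ⋙ functor = T'.functor

/-- The category of second-order algebraic theories and algebraic translations. -/
instance : Category.{v} Theory.{v} where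
  Hom := Translation
  id T := ⟨𝟭 T.Carrier, inferInstance, Functor.comp_id _⟩
  comp F G := ⟨F.functor ⋙ G.functor,
    have := F.cartesian
    have := G.cartesian
    inferInstance,
    by rw [← Functor.assoc, F.comm, G.comm]⟩
  id_comp _ := Translation.ext (Functor.id_comp _)
  comp_id _ := Translation.ext (Functor.comp_id _)
  assoc _ _ _ := Translation.ext (Functor.assoc _ _ _)

/-! ## The theory of a presentation -/

namespace Presentation

/-- The morphisms of the classifying category `𝕄(E)`: tuples of equivalence classes of terms
modulo provable equality in `E`. -/
abbrev ClassTuple (E : Presentation.{v}) (Θ Θ' : List ℕ) : Type v :=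
  ∀ n, Position n Θ' → E.Class Θ n

variable {E : Presentation.{v}}

/-- Composition of tuples of equivalence classes, by metasubstitution of representatives. -/
noncomputable def compTuple {Θ Θ' Θ'' : List ℕ} (s : E.ClassTuple Θ Θ')
    (t : E.ClassTuple Θ' Θ'') : E.ClassTuple Θ Θ'' :=
  fun n q => cls ((rep (t n q)).inst fun m p => rep (s m p))

/-- Composition does not depend on the choice of representatives. -/
theorem compTuple_cls {Θ Θ' Θ'' : List ℕ} (s : ∀ n, Position n Θ' → Term E.sig Θ n)
    (t : ∀ n, Position n Θ'' → Term E.sig Θ' n) :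
    compTuple (fun n p => cls (s n p)) (fun n q => cls (t n q)) =
      fun n q => cls ((t n q).inst s) := by
  funext n q
  exact cls_eq_cls.2 ((rep_cls _).inst fun _ _ => rep_cls _)

theorem exists_tuple {Θ Θ' : List ℕ} (s : E.ClassTuple Θ Θ') :
    ∃ s' : ∀ n, Position n Θ' → Term E.sig Θ n, s = fun n p => cls (s' n p) :=
  ⟨fun n p => rep (s n p), by funext n p; exact (cls_rep _).symm⟩

variable (E)

/-- The classifying category `𝕄(E)`. -/
@[reducible]
noncomputable def classifyingCategory : Category.{v} (List ℕ) where
  Hom Θ Θ' := E.ClassTuple Θ Θ'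
  id _ := fun _ i => cls (.mvar i .var)
  comp s t := compTuple s t
  id_comp t := by
    obtain ⟨t, rfl⟩ := exists_tuple t
    rw [compTuple_cls]
    funext n q
    rw [Term.inst_id]
  comp_id s := by
    obtain ⟨s, rfl⟩ := exists_tuple s
    rw [compTuple_cls]
    funext n q
    exact congrArg cls ((Term.inst_mvar _ _ _).trans (Term.subst_var _))
  assoc r s t := by
    obtain ⟨r, rfl⟩ := exists_tuple r
    obtain ⟨s, rfl⟩ := exists_tuple s
    obtain ⟨t, rfl⟩ := exists_tuple t
    simp only [compTuple_cls, Term.inst_inst]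

/-- The canonical functor `M_E : 𝕄 ⟶ 𝕄(E)`, which is the identity on objects and sends a tuple of
elementary terms to the tuple of their equivalence classes. -/
noncomputable def classifyingFunctor : IdOnObjects.{v} where
  cat := E.classifyingCategory
  map s := fun n q => cls (s n q).ofElementary
  map_id _ := rfl
  map_comp s t := by
    refine Eq.trans ?_ (compTuple_cls _ _).symm
    funext n q
    exact congrArg cls (Term.ofElementary_inst _ _)

theorem comp_fst {Ξ Θ Θ' : List ℕ}
    (s : E.classifyingFunctor.of Ξ ⟶ E.classifyingFunctor.of (Θ ++ Θ')) :
    s ≫ E.classifyingFunctor.functor.map (EqTheory.fst Θ Θ') =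
      (fun n p => s n (p.inl Θ') : E.ClassTuple Ξ Θ) := by
  obtain ⟨s, rfl⟩ := exists_tuple (E := E) s
  refine (compTuple_cls s _).trans ?_
  funext n p
  refine congrArg cls ?_
  refine (Term.inst_mvar _ _ _).trans ?_
  exact Term.subst_var _

theorem comp_snd {Ξ Θ Θ' : List ℕ}
    (s : E.classifyingFunctor.of Ξ ⟶ E.classifyingFunctor.of (Θ ++ Θ')) :
    s ≫ E.classifyingFunctor.functor.map (EqTheory.snd Θ Θ') =
      (fun n p => s n (p.inr Θ) : E.ClassTuple Ξ Θ') := by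
  obtain ⟨s, rfl⟩ := exists_tuple (E := E) s
  refine (compTuple_cls s _).trans ?_
  funext n p
  refine congrArg cls ?_
  refine (Term.inst_mvar _ _ _).trans ?_
  exact Term.subst_var _

/-- In `𝕄(E)` the empty sequence is terminal. -/
noncomputable def isTerminalNil : IsTerminal (E.classifyingFunctor.of []) :=
  IsTerminal.ofUniqueHom (fun _ => (fun _ p => nomatch p : E.ClassTuple _ []))
    (fun _ _ => by funext n p; exact nomatch p)

/-- In `𝕄(E)` concatenation of sequences is the product. -/
noncomputable def isProductAppend (Θ Θ' : List ℕ) : IsLimit (E.classifyingFunctor.productCone Θ Θ') :=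
  BinaryFan.isLimitMk
    (fun c => (fun n p => Position.elim (c.fst n) (c.snd n) p : E.ClassTuple c.pt (Θ ++ Θ')))
    (fun c => by
      refine (comp_fst E _).trans ?_
      funext n p
      exact Position.elim_inl _ _ _)
    (fun c => by
      refine (comp_snd E _).trans ?_
      funext n p
      exact Position.elim_inr _ _ _)
    (fun c m h₁ h₂ => by
      funext n p
      have h₁' := (comp_fst E _).symm.trans h₁
      have h₂' := (comp_snd E _).symm.trans h₂
      rcases p.inl_or_inr with ⟨q, rfl⟩ | ⟨q, rfl⟩
      · exact (congrFun (congrFun h₁' n) q).trans (Position.elim_inl _ _ _).symm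
      · exact (congrFun (congrFun h₂' n) q).trans (Position.elim_inr _ _ _).symm)

end Presentation

/-- The substitution `xₘ₊₁ := N[]`, where `N : [0]` is the last metavariable. -/
def paramSub {S : Signature.{v}} (Ξ : List ℕ) (m : ℕ) : Fin (m + 1) → Term S (Ξ ++ [0]) m :=
  Fin.addCases (m := m) (n := 1) .var fun _ => .mvar (Position.inr Ξ .head) Fin.elim0

/-- Replace the last variable by the last metavariable. -/
def param {S : Signature.{v}} {Ξ : List ℕ} {m : ℕ} (t : Term S Ξ (m + 1)) : Term S (Ξ ++ [0]) m :=
  (t.inst fun _ p => .mvar (p.inl [0]) .var).subst (paramSub Ξ m)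

/-- The metasubstitution of a variable for the last metavariable, leaving the others fixed. -/
def unparamSub {S : Signature.{v}} (Ξ : List ℕ) (a : ℕ) (p : Position a (Ξ ++ [0])) :
    Term S Ξ (1 + a) :=
  Position.elim (fun q => .mvar q fun j => .var (Fin.natAdd 1 j))
    (fun _ => .var (Fin.castAdd a 0)) p

/-- Replace the last metavariable by a new last variable. -/
def unparam {S : Signature.{v}} {Ξ : List ℕ} {m : ℕ} (t : Term S (Ξ ++ [0]) m) :
    Term S Ξ (m + 1) :=
  (t.rename (Fin.castAdd 1)).msubst
    fun a p => (unparamSub Ξ a p).rename (liftRen (Fin.natAdd m) a)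

theorem param_unparam {S : Signature.{v}} {Ξ : List ℕ} {m : ℕ} (t : Term S (Ξ ++ [0]) m) :
    param (unparam t) = t := by
  rw [param, unparam, Term.inst_msubst, Term.msubst_rename_subst _ _ _ _
    (fun x => by simp [paramSub])]
  refine Eq.trans ?_ (Term.inst_id t)
  rw [Term.inst]
  congr 1
  funext a p
  rcases p.inl_or_inr with ⟨q, rfl⟩ | ⟨q, rfl⟩
  · simp [unparamSub, Position.elim_inl, Term.rename, Term.inst_mvar, Term.inst_var, Term.subst,
      liftRen, Term.liftSub]
  · cases q with
    | head =>
      simp only [unparamSub, Position.elim_inr, Term.rename, Term.inst_var, Term.subst,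
        Term.liftRen_castAdd, Term.liftSub_castAdd]
      simp only [paramSub, Fin.addCases_right, Term.rename]
      congr 1
      funext j
      exact j.elim0
    | tail q => exact nomatch q

theorem unparam_param {S : Signature.{v}} {Ξ : List ℕ} {m : ℕ} (t : Term S Ξ (m + 1)) :
    unparam (param t) = t := by
  rw [param, unparam, Term.rename_subst, Term.inst_inl_subst_msubst]
  · refine Eq.trans ?_ (Term.subst_var t)
    congr 1
    refine Term.addCases_ext (fun x => ?_) (fun x => ?_)
    · simp [paramSub, Term.rename, Term.msubst]
    · simp only [paramSub, Fin.addCases_right, Term.rename, Term.msubst, unparamSub,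
        Position.elim_inr, Term.subst, Term.liftRen_castAdd, Fin.addCases_left]
      congr 2
      exact Subsingleton.elim _ _
  · intro a p
    simp [unparamSub, Position.elim_inl, Term.rename, liftRen]

namespace Presentation

variable {E : Presentation.{v}}

theorem Derivable.unparam {Ξ : List ℕ} {m : ℕ} {s t : Term E.sig (Ξ ++ [0]) m}
    (h : E.Derivable s t) : E.Derivable (unparam s) (unparam t) :=
  Derivable.msubst h fun _ _ => Derivable.refl _

variable (E)

theorem comp_ev {Ξ Θ : List ℕ} (s : ∀ n, Position n (Θ.map (· + 1)) → Term E.sig Ξ n) :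
    (E.isProductAppend (Θ.map (· + 1)) [0]).lift
        (BinaryFan.mk (P := E.classifyingFunctor.of (Ξ ++ [0]))
          (E.classifyingFunctor.functor.map (EqTheory.fst Ξ [0]) ≫
            (fun n p => cls (s n p) : E.ClassTuple Ξ (Θ.map (· + 1))))
          (E.classifyingFunctor.functor.map (EqTheory.snd Ξ [0]))) ≫
      E.classifyingFunctor.functor.map (EqTheory.ev Θ) =
    (fun n q => cls (param (s (n + 1) q.succ)) : E.ClassTuple (Ξ ++ [0]) Θ) := by
  have h₁ : (E.isProductAppend (Θ.map (· + 1)) [0]).lift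
        (BinaryFan.mk (P := E.classifyingFunctor.of (Ξ ++ [0]))
          (E.classifyingFunctor.functor.map (EqTheory.fst Ξ [0]) ≫
            (fun n p => cls (s n p) : E.ClassTuple Ξ (Θ.map (· + 1))))
          (E.classifyingFunctor.functor.map (EqTheory.snd Ξ [0]))) =
      (fun n p => cls (Position.elim (α := Term E.sig (Ξ ++ [0]) n)
        (fun q => (s n q).inst fun _ p => .mvar (p.inl [0]) .var)
        (fun q => .mvar (q.inr Ξ) .var) p) :
        E.ClassTuple (Ξ ++ [0]) (Θ.map (· + 1) ++ [0])) := by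
    funext n p
    rcases p.inl_or_inr with ⟨q, rfl⟩ | ⟨q, rfl⟩
    · rw [Position.elim_inl]
      refine (Position.elim_inl _ _ _).trans ?_
      exact congrFun (congrFun (compTuple_cls (E := E) _ s) n) q
    · rw [Position.elim_inr]
      exact Position.elim_inr _ _ _
  rw [h₁]
  refine (compTuple_cls _ _).trans ?_
  funext n q
  refine congrArg cls ?_
  refine (Term.inst_mvar _ _ _).trans ?_
  rw [Position.elim_inl, param]
  congr 1
  refine Term.addCases_ext (fun x => ?_) (fun x => ?_)
  · simp only [paramSub, Fin.addCases_left, Term.ofElementary]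
    exact Term.inst_var _ _
  · simp only [paramSub, Fin.addCases_right, Term.ofElementary]
    refine (Term.inst_mvar _ _ _).trans ?_
    rw [Position.elim_inr]
    simp only [Term.subst]
    congr 1
    funext j
    exact j.elim0

/-- The second-order algebraic theory `M_E : 𝕄 ⟶ 𝕄(E)` of a presentation `E`. -/
noncomputable def theory : Theory.{v} where
  toIdOnObjects := E.classifyingFunctor
  isTerminal := E.isTerminalNil
  isProduct := E.isProductAppend
  exists_unique_mate Ξ Θ f := by
    obtain ⟨f, rfl⟩ := exists_tuple (E := E) f
    refine ⟨(fun n p => cls (Position.unsucc (α := fun n => Term E.sig Ξ n)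
      (fun m q => unparam (f m q)) n p) : E.ClassTuple Ξ (Θ.map (· + 1))), ?_, ?_⟩
    · refine (comp_ev E _).trans ?_
      funext n q
      rw [Position.unsucc_succ, param_unparam]
    · intro g hg
      obtain ⟨g, rfl⟩ := exists_tuple (E := E) g
      have hg' := (comp_ev E g).symm.trans hg
      funext n p
      refine Position.succ_cases (P := fun n p => cls (g n p) =
        cls (Position.unsucc (α := fun n => Term E.sig Ξ n)
          (fun m q => unparam (f m q)) n p)) ?_ n p
      intro m q
      rw [Position.unsucc_succ]
      have h := (cls_eq_cls.1 (congrFun (congrFun hg' m) q)).unparam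
      rw [unparam_param] at h
      exact cls_eq_cls.2 h

end Presentation

/-! ## The presentation of a theory -/

namespace Theory

variable (T : Theory.{v})

/-- The signature of the internal language: for every `f : (m₁, …, mₖ) ⟶ (n)` in `𝓜` an operator
`ω_f` of arity `(m₁, …, mₖ, 0, …, 0)`, with `n` zeros. -/
def internalSignature : Signature.{v} where
  Op := Σ (Θ : List ℕ) (n : ℕ), (T.of Θ ⟶ T.of [n])
  arity ω := ω.1 ++ List.replicate ω.2.1 0

variable {T}

/-- The term `t_f = ω_f((x⃗₁) M₁[x⃗₁], …, (x⃗ₖ) Mₖ[x⃗ₖ], x₁, …, xₙ)` for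
`f : (m₁, …, mₖ) ⟶ (n)`, in the context `M₁ : [m₁], …, Mₖ : [mₖ] ▹ x₁, …, xₙ`. -/
def opTerm {Θ : List ℕ} {n : ℕ} (f : T.of Θ ⟶ T.of [n]) : Term T.internalSignature Θ n :=
  .op ⟨Θ, n, f⟩ fun m => Position.elim
    (fun i : Position m Θ => .mvar i fun j => .var (Fin.natAdd n j))
    (fun j : Position m (List.replicate n 0) =>
      .var (Fin.castAdd m (Fin.cast List.length_replicate j.index)))

/-- The axioms (E1) and (E2) of the internal language:
* (E1) `s ≡ t_{M⟨s⟩}` for every morphism `⟨s⟩ : Θ ⟶ (n)` of `𝕄`;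
* (E2) `t_h ≡ t_g {Mᵢ := (x⃗ᵢ) t_{fᵢ}}` whenever `h = g ∘ ⟨f₁, …, fₗ⟩` in `𝓜`.  That `φ` is the
  tuple `⟨f₁, …, fₗ⟩` is expressed by `πᵢ ∘ φ = fᵢ` for all `i`. -/
inductive InternalEquation : ∀ {Θ : List ℕ} {n : ℕ},
    Term T.internalSignature Θ n → Term T.internalSignature Θ n → Prop
  | e1 {Θ : List ℕ} {n : ℕ} (s : Term emptySignature Θ n) :
      InternalEquation s.ofElementary (opTerm (T.functor.map (EqTheory.single s)))
  | e2 {Θ Θ' : List ℕ} {n : ℕ} (h : T.of Θ ⟶ T.of [n]) (g : T.of Θ' ⟶ T.of [n])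
      (f : ∀ m, Position m Θ' → (T.of Θ ⟶ T.of [m])) (φ : T.of Θ ⟶ T.of Θ')
      (hφ : ∀ m (i : Position m Θ'), φ ≫ T.functor.map (EqTheory.proj i) = f m i)
      (hh : h = φ ≫ g) :
      InternalEquation (opTerm h) ((opTerm g).inst fun m i => opTerm (f m i))

variable (T)

/-- The internal language `IL(M)` of a second-order algebraic theory `M`. -/
def internalLanguage : Presentation.{v} where
  sig := T.internalSignature
  Eqn := InternalEquation

end Theory

end SecondOrder

/-! The comparison functor `toClassifying` is the identity on objects and sends `f` to the tuple of
classes of the terms `t_{πᵢ ∘ f}`. Axiom (E1) makes it preserve identities and commute with the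
functors from `𝕄`, and (E2) makes it preserve composites. Once it is bijective on hom-sets it has a
strict inverse, and both functors preserve finite products because they are equivalences. So the
content is faithfulness and fullness.

Faithfulness is soundness of a semantics in `T`. The object `(m)` behaves as `(0)ᵐ ⇒ (0)`: morphisms
`C ⟶ (m)` correspond, naturally in `C`, to morphisms `C × (0)ᵐ ⟶ (0)`, by `app` and `lam`
(`exists_unique_lam`, from preservation of the exponentiable object `(0)`). A term is then evaluated
at a stage `C` in an environment of morphisms `C ⟶ (m)` for metavariables and `C ⟶ (0)` for
variables. Metasubstitution becomes a change of environment (`eval_msubst`), so derivable equations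
hold (`eval_eq_of_derivable`). Evaluating `t_f` in the generic environment recovers `f`, which gives
`eq_of_derivable_opTerm`.

Fullness says that every term is provably equal to some `t_f` (`representable`), by induction on
terms. Elementary terms are covered by (E1), and metasubstitution by (E2). The hard case is an
operator whose arguments have free variables, since (E2) only substitutes terms without parameters.
There the free variables are traded one by one for nullary metavariables, and the trade is undone by
transposing along the exponential (`representable_of_param`). -/

namespace SecondOrder

/-! ### Positions in constant lists -/

namespace Position

/-- The `j`-th position of the constant list. -/
def ofFin {c : ℕ} : {n : ℕ} → Fin n → Position c (List.replicate n c)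
  | 0, j => j.elim0
  | _ + 1, j => Fin.cases head (fun j => tail (ofFin j)) j

/-- Definition by cases on a position of the constant list. -/
def replicateCases {α : ℕ → Sort*} {c : ℕ} : {n : ℕ} → (Fin n → α c) →
    ∀ m, Position m (List.replicate n c) → α m
  | 0, _ => fun _ p => nomatch p
  | _ + 1, b => cases (b 0) (replicateCases fun j => b j.succ)

theorem replicateCases_ofFin {α : ℕ → Sort*} {c n : ℕ} (b : Fin n → α c) (j : Fin n) :
    replicateCases b c (ofFin j) = b j := by
  induction n with
  | zero => exact j.elim0
  | succ n ih =>
    induction j using Fin.cases with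
    | zero => rfl
    | succ j => exact ih (fun j => b j.succ) j

theorem forall_replicate {c n : ℕ} {P : ∀ m, Position m (List.replicate n c) → Prop}
    (h : ∀ j, P c (ofFin j)) : ∀ m p, P m p := by
  induction n with
  | zero => exact fun _ p => nomatch p
  | succ n ih =>
    intro m p
    cases p with
    | head => exact h 0
    | tail p => exact ih (P := fun m p => P m (tail p)) (fun j => h j.succ) m p

theorem index_ofFin {c n : ℕ} (j : Fin n) :
    Fin.cast List.length_replicate (ofFin (c := c) j).index = j := by
  induction n with
  | zero => exact j.elim0
  | succ n ih =>
    induction j using Fin.cases with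
    | zero => rfl
    | succ j => exact congrArg Fin.succ (ih j)

end Position

/-! ### Projections and single terms in the theory of equality -/

namespace EqTheory

theorem single_eta {Θ : List ℕ} {n : ℕ} (s : of Θ ⟶ of [n]) : single (s n .head) = s := by
  funext m p
  cases p with
  | head => rfl
  | tail p => exact nomatch p

theorem comp_single {Θ Θ' : List ℕ} {n : ℕ} (s : of Θ ⟶ of Θ') (t : Term emptySignature Θ' n) :
    s ≫ single t = single (t.inst s) :=
  (single_eta _).symm

theorem comp_proj {Θ Θ' : List ℕ} {n : ℕ} (s : of Θ ⟶ of Θ') (p : Position n Θ') :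
    s ≫ proj p = single (s n p) :=
  (comp_single s _).trans (congrArg single ((Term.inst_mvar _ _ _).trans (Term.subst_var _)))

theorem proj_head (m : ℕ) : proj (.head : Position m [m]) = 𝟙 (of [m]) := single_eta (𝟙 (of [m]))

end EqTheory

/-! ### Finite products in a second-order algebraic theory -/

namespace Theory

variable (T : Theory.{v})

/-- The image in `T` of a projection. -/
abbrev pr {Θ : List ℕ} {m : ℕ} (i : Position m Θ) : T.of Θ ⟶ T.of [m] :=
  T.functor.map (EqTheory.proj i)

/-- The image in `T` of an elementary term. -/
abbrev el {Θ : List ℕ} {n : ℕ} (s : Term emptySignature Θ n) : T.of Θ ⟶ T.of [n] :=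
  T.functor.map (EqTheory.single s)

/-- The image in `T` of a tuple of elementary terms. -/
abbrev els {Θ Θ' : List ℕ} (s : EqTheory.of Θ ⟶ EqTheory.of Θ') : T.of Θ ⟶ T.of Θ' :=
  T.functor.map s

variable {T}

theorem map_comp_map {Θ Θ' Θ'' : List ℕ} (s : EqTheory.of Θ ⟶ EqTheory.of Θ')
    (t : EqTheory.of Θ' ⟶ EqTheory.of Θ'') : T.els s ≫ T.els t = T.els (s ≫ t) :=
  (T.functor.map_comp s t).symm

theorem els_comp_el {Θ Θ' : List ℕ} {n : ℕ} (s : EqTheory.of Θ ⟶ EqTheory.of Θ')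
    (t : Term emptySignature Θ' n) : T.els s ≫ T.el t = T.el (t.inst s) :=
  (map_comp_map _ _).trans (congrArg T.els (EqTheory.comp_single _ _))

theorem els_comp_pr {Θ Θ' : List ℕ} {n : ℕ} (s : EqTheory.of Θ ⟶ EqTheory.of Θ')
    (p : Position n Θ') : T.els s ≫ T.pr p = T.el (s n p) :=
  (map_comp_map _ _).trans (congrArg T.els (EqTheory.comp_proj _ _))

theorem pr_head (m : ℕ) : T.pr (.head : Position m [m]) = 𝟙 (T.of [m]) :=
  (congrArg T.els (EqTheory.proj_head m)).trans (T.functor.map_id _)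

theorem exists_unique_append {Θ Θ' : List ℕ} {C : T.Carrier} (a : C ⟶ T.of Θ) (b : C ⟶ T.of Θ') :
    ∃! h : C ⟶ T.of (Θ ++ Θ'), h ≫ T.els (EqTheory.fst Θ Θ') = a ∧
      h ≫ T.els (EqTheory.snd Θ Θ') = b :=
  ⟨(T.isProduct Θ Θ').lift (BinaryFan.mk a b),
    ⟨(T.isProduct Θ Θ').fac _ ⟨.left⟩, (T.isProduct Θ Θ').fac _ ⟨.right⟩⟩,
    fun _ h => BinaryFan.IsLimit.hom_ext (T.isProduct Θ Θ')
      (h.1.trans ((T.isProduct Θ Θ').fac (BinaryFan.mk a b) ⟨.left⟩).symm)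
      (h.2.trans ((T.isProduct Θ Θ').fac (BinaryFan.mk a b) ⟨.right⟩).symm)⟩

/-- Binary products and the terminal object give all finite ones: `a :: Θ` is definitionally `[a] ++
Θ`, so the induction splits off one factor at a time. -/
theorem exists_unique_tuple {Θ : List ℕ} {C : T.Carrier} (ρ : ∀ m, Position m Θ → (C ⟶ T.of [m])) :
    ∃! h : C ⟶ T.of Θ, ∀ m i, h ≫ T.pr i = ρ m i := by
  induction Θ with
  | nil => exact ⟨T.isTerminal.from C, fun _ p => (nomatch p), fun _ _ => T.isTerminal.hom_ext _ _⟩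
  | cons a Θ ih =>
    have hfst : T.els (EqTheory.fst [a] Θ) = T.pr (.head : Position a (a :: Θ)) :=
      congrArg T.els (EqTheory.single_eta _).symm
    have hsnd : ∀ {m} (i : Position m Θ), T.els (EqTheory.snd [a] Θ) ≫ T.pr i = T.pr i.tail :=
      fun i => els_comp_pr _ i
    obtain ⟨t, ht, ht'⟩ := ih fun m i => ρ m i.tail
    obtain ⟨h, ⟨h₁, h₂⟩, h₃⟩ := exists_unique_append (ρ a .head) t
    refine ⟨h, ?_, fun k hk => h₃ k ⟨?_, ht' _ ?_⟩⟩
    · intro m i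
      cases i with
      | head => exact (congrArg (h ≫ ·) hfst).symm.trans h₁
      | tail i =>
        rw [← ht m i, ← h₂, Category.assoc]
        exact congrArg (h ≫ ·) (hsnd i).symm
    · exact (congrArg (k ≫ ·) hfst).trans (hk a .head)
    · intro m i
      rw [Category.assoc]
      exact (congrArg (k ≫ ·) (hsnd i)).trans (hk m i.tail)

/-- Tupling of morphisms `C ⟶ [m]`. -/
noncomputable def tuple {Θ : List ℕ} {C : T.Carrier} (ρ : ∀ m, Position m Θ → (C ⟶ T.of [m])) :
    C ⟶ T.of Θ :=
  (exists_unique_tuple ρ).choose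

theorem tuple_pr {Θ : List ℕ} {C : T.Carrier} (ρ : ∀ m, Position m Θ → (C ⟶ T.of [m])) {m : ℕ}
    (i : Position m Θ) : tuple ρ ≫ T.pr i = ρ m i :=
  (exists_unique_tuple ρ).choose_spec.1 m i

theorem hom_ext {Θ : List ℕ} {C : T.Carrier} {f g : C ⟶ T.of Θ}
    (h : ∀ m (i : Position m Θ), f ≫ T.pr i = g ≫ T.pr i) : f = g :=
  (exists_unique_tuple fun _ i => g ≫ T.pr i).unique h fun _ _ => rfl

theorem comp_tuple {Θ : List ℕ} {C D : T.Carrier} (h : D ⟶ C)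
    (ρ : ∀ m, Position m Θ → (C ⟶ T.of [m])) : h ≫ tuple ρ = tuple fun m i => h ≫ ρ m i :=
  hom_ext fun _ _ => by simp only [Category.assoc, tuple_pr]

/-! ### Application -/

/-- The elementary term `M[N₁[], …, Nₘ[]]` in the context `M : [m], N₁ : [0], …, Nₘ : [0]`. -/
def applyTerm (m : ℕ) : Term emptySignature (m :: List.replicate m 0) 0 :=
  .mvar .head fun j => .mvar (.tail (.ofFin j)) Fin.elim0

/-- Application of `a : C ⟶ [m]`, that is `(0)ᵐ ⇒ (0)`, to arguments in `(0)`. -/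
noncomputable def app {m : ℕ} {C : T.Carrier} (a : C ⟶ T.of [m]) (b : Fin m → (C ⟶ T.of [0])) :
    C ⟶ T.of [0] :=
  tuple (Position.cases (α := fun m => C ⟶ T.of [m]) a (Position.replicateCases b)) ≫
    T.el (applyTerm m)

theorem comp_app {m : ℕ} {C D : T.Carrier} (h : D ⟶ C) (a : C ⟶ T.of [m])
    (b : Fin m → (C ⟶ T.of [0])) : h ≫ app a b = app (h ≫ a) fun j => h ≫ b j := by
  rw [app, ← Category.assoc, comp_tuple, app]
  congr 2
  funext k i
  cases i with
  | head => rfl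
  | tail i =>
    refine Position.forall_replicate (P := fun k i =>
      h ≫ Position.replicateCases (α := fun m => C ⟶ T.of [m]) b k i =
      Position.replicateCases (α := fun m => D ⟶ T.of [m]) (fun j => h ≫ b j) k i) (fun j => ?_) k i
    rw [Position.replicateCases_ofFin, Position.replicateCases_ofFin]

/-- By naturality of `app` only the generic case `d = 𝟙` matters. There everything lies in the image
of `𝕄`, where composition is metasubstitution into `M[N₁[], …, Nₘ[]]`. -/
theorem app_el {m : ℕ} {Θ : List ℕ} {C : T.Carrier} (d : C ⟶ T.of Θ) (s : Term emptySignature Θ m)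
    (b : Fin m → Term emptySignature Θ 0) :
    app (d ≫ T.el s) (fun j => d ≫ T.el (b j)) = d ≫ T.el (s.subst b) := by
  rw [← comp_app d (T.el s)]
  congr 1
  let S : EqTheory.of Θ ⟶ EqTheory.of (m :: List.replicate m 0) :=
    Position.cases s (Position.replicateCases b)
  have h : tuple (Position.cases (α := fun m => T.of Θ ⟶ T.of [m]) (T.el s)
      (Position.replicateCases fun j => T.el (b j))) = T.els S := by
    refine hom_ext fun k i => ?_
    rw [tuple_pr, els_comp_pr]
    cases i with
    | head => rfl
    | tail i =>
      refine Position.forall_replicate (P := fun k i =>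
        Position.replicateCases (α := fun m => T.of Θ ⟶ T.of [m]) (fun j => T.el (b j)) k i =
        T.el (Position.replicateCases b k i)) (fun j => ?_) k i
      rw [Position.replicateCases_ofFin, Position.replicateCases_ofFin]
  rw [app, h, els_comp_el, applyTerm, Term.inst_mvar]
  congr 3
  -- Each `Nⱼ` is nullary, so instantiating `Nⱼ[]` substitutes along the only map out of `Fin 0`,
  -- which is the identity substitution.
  funext j
  rw [Term.inst_mvar]
  refine Eq.trans ?_ (Term.subst_var _)
  refine congrArg₂ Term.subst (Subsingleton.elim _ _) (Position.replicateCases_ofFin b j)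

theorem app_nil {C : T.Carrier} (a : C ⟶ T.of [0]) (b : Fin 0 → (C ⟶ T.of [0])) :
    app a b = a := by
  have h := app_el a (.mvar .head .var) (fun j : Fin 0 => j.elim0)
  have h' : a ≫ T.el (.mvar .head .var) = a :=
    (congrArg (a ≫ ·) (pr_head 0)).trans (Category.comp_id a)
  rw [Subsingleton.elim (fun j : Fin 0 => j.elim0) Term.var, Term.subst_var, h'] at h
  rw [← Subsingleton.elim _ b]
  exact h

/-! ### Context extension -/

/-- `w : D ⟶ C` and `v` exhibit `D` as the product of `C` and `(0)ᵐ`. -/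
def IsExtension {m : ℕ} {C D : T.Carrier} (w : D ⟶ C) (v : Fin m → (D ⟶ T.of [0])) : Prop :=
  ∀ (E : T.Carrier) (a : E ⟶ C) (b : Fin m → (E ⟶ T.of [0])),
    ∃! h : E ⟶ D, h ≫ w = a ∧ ∀ j, h ≫ v j = b j

/-- The product of `C` and `(0)ᵐ`. -/
def ext (C : T.Carrier) (m : ℕ) : T.Carrier :=
  HAppend.hAppend (α := List ℕ) C (List.replicate m 0)

/-- The projection from `C × (0)ᵐ` to `C`. -/
def wk (C : T.Carrier) (m : ℕ) : ext C m ⟶ C := T.els (EqTheory.fst C (List.replicate m 0))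

/-- The projections from `C × (0)ᵐ` to `(0)`. -/
def vr (C : T.Carrier) {m : ℕ} (j : Fin m) : ext C m ⟶ T.of [0] :=
  T.pr (Position.inr C (Position.ofFin j))

/-- The `m` morphisms to `(0)` are bundled into one morphism to the constant list, which reduces the
claim to a binary product. -/
theorem exists_unique_extension {Θ : List ℕ} {m : ℕ} {C : T.Carrier} (a : C ⟶ T.of Θ)
    (b : Fin m → (C ⟶ T.of [0])) :
    ∃! h : C ⟶ T.of (Θ ++ List.replicate m 0),
      h ≫ T.els (EqTheory.fst Θ (List.replicate m 0)) = a ∧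
        ∀ j, h ≫ T.pr (Position.inr Θ (Position.ofFin j)) = b j := by
  obtain ⟨h, ⟨h₁, h₂⟩, h₃⟩ := exists_unique_append a (tuple (Position.replicateCases
    (α := fun m => C ⟶ T.of [m]) b))
  have hv : ∀ j : Fin m, T.pr (Position.inr Θ (Position.ofFin j)) =
      T.els (EqTheory.snd Θ (List.replicate m 0)) ≫ T.pr (Position.ofFin (c := 0) j) :=
    fun j => (els_comp_pr (EqTheory.snd Θ (List.replicate m 0)) _).symm
  refine ⟨h, ⟨h₁, fun j => ?_⟩, fun k hk => h₃ k ⟨hk.1, hom_ext ?_⟩⟩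
  · rw [hv, ← Category.assoc, h₂, tuple_pr,
      Position.replicateCases_ofFin (α := fun m => C ⟶ T.of [m])]
  · refine Position.forall_replicate fun j => ?_
    rw [tuple_pr, Position.replicateCases_ofFin (α := fun m => C ⟶ T.of [m]), ← hk.2 j, hv,
      Category.assoc]

theorem isExtension_ext (C : T.Carrier) (m : ℕ) : IsExtension (wk C m) (vr C (m := m)) :=
  fun _ a b => exists_unique_extension a b

/-- Pairing into `C × (0)ᵐ`. -/
noncomputable def pair {m : ℕ} {C E : T.Carrier} (a : E ⟶ C) (b : Fin m → (E ⟶ T.of [0])) :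
    E ⟶ ext C m :=
  (isExtension_ext C m E a b).choose

theorem pair_wk {m : ℕ} {C E : T.Carrier} (a : E ⟶ C) (b : Fin m → (E ⟶ T.of [0])) :
    pair a b ≫ wk C m = a :=
  (isExtension_ext C m E a b).choose_spec.1.1

theorem pair_vr {m : ℕ} {C E : T.Carrier} (a : E ⟶ C) (b : Fin m → (E ⟶ T.of [0])) (j : Fin m) :
    pair a b ≫ vr C j = b j :=
  (isExtension_ext C m E a b).choose_spec.1.2 j

/-- Arbitrary arguments `b` become values of fresh nullary metavariables. This brings application to
them within reach of `app_el`, which only knows elementary arguments. -/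
theorem exists_extension {Θ : List ℕ} {m : ℕ} {C : T.Carrier} (c : C ⟶ T.of Θ)
    (b : Fin m → (C ⟶ T.of [0])) :
    ∃ d : C ⟶ T.of (Θ ++ List.replicate m 0),
      (∀ {n} (s : Term emptySignature Θ n),
        d ≫ T.el (s.inst fun _ p => .mvar (p.inl (List.replicate m 0)) .var) = c ≫ T.el s) ∧
        ∀ j, d ≫ T.el (.mvar (Position.inr Θ (Position.ofFin j)) .var) = b j := by
  obtain ⟨d, ⟨hd, hd'⟩, -⟩ := exists_unique_extension c b
  refine ⟨d, fun s => ?_, hd'⟩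
  rw [← hd, Category.assoc, els_comp_el]
  rfl

theorem app_var {m : ℕ} {Θ : List ℕ} {C : T.Carrier} (c : C ⟶ T.of Θ) (x : Fin m)
    (b : Fin m → (C ⟶ T.of [0])) : app (c ≫ T.el (.var x)) b = b x := by
  obtain ⟨d, hd, hd'⟩ := exists_extension c b
  rw [← funext hd', ← hd]
  exact app_el _ _ _

theorem app_mvar {m k : ℕ} {Θ : List ℕ} {C : T.Carrier} (c : C ⟶ T.of Θ) (i : Position k Θ)
    (t : Fin k → Term emptySignature Θ m) (b : Fin m → (C ⟶ T.of [0])) :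
    app (c ≫ T.el (.mvar i t)) b = app (c ≫ T.pr i) fun j => app (c ≫ T.el (t j)) b := by
  obtain ⟨d, hd, hd'⟩ := exists_extension c b
  -- Over the enlarged context, application to `b` is substitution of the fresh metavariables for
  -- the variables; the claim then follows from how substitution acts on `.mvar`.
  have key : ∀ s : Term emptySignature Θ m, app (c ≫ T.el s) b = d ≫
      T.el ((s.inst fun _ p => .mvar (p.inl (List.replicate m 0)) .var).subst
        fun j => .mvar (Position.inr Θ (Position.ofFin j)) .var) := fun s => by
    rw [← funext hd', ← hd]
    exact app_el _ _ _
  simp only [key]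
  have hi : T.pr i = T.el (.mvar i .var) := rfl
  rw [hi, ← hd, app_el]
  simp only [Term.inst_mvar, Term.inst_var, Term.subst]

/-- Currying: evaluation is the elementary term `M[x₁, …, xₘ, N[]]`, so it supplies the last of the
`m + 1` arguments and leaves the first `m` open. -/
theorem app_ev {m : ℕ} {C : T.Carrier} (e : C ⟶ T.of ([m + 1] ++ [0]))
    (b : Fin m → (C ⟶ T.of [0])) :
    app (e ≫ T.els (EqTheory.ev [m])) b =
      app (e ≫ T.els (EqTheory.fst [m + 1] [0]))
        (Fin.addCases (m := m) (n := 1) b fun _ => e ≫ T.els (EqTheory.snd [m + 1] [0])) := by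
  have h : EqTheory.ev [m] = EqTheory.single (.mvar (Position.head : Position (m + 1) [m + 1, 0])
      (Fin.addCases (m := m) (n := 1) .var fun _ => .mvar (.tail .head) Fin.elim0)) :=
    (EqTheory.single_eta _).symm
  have h₁ : EqTheory.fst [m + 1] [0] = EqTheory.proj (.head : Position (m + 1) [m + 1, 0]) :=
    (EqTheory.single_eta _).symm
  have h₂ : EqTheory.snd [m + 1] [0] = EqTheory.proj (.tail .head : Position 0 [m + 1, 0]) :=
    (EqTheory.single_eta _).symm
  rw [h, h₁, h₂]
  refine (app_mvar e _ _ b).trans ?_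
  congr 1
  refine Term.addCases_ext (fun x => ?_) (fun x => ?_)
  · simp only [Fin.addCases_left]
    exact app_var _ _ _
  · simp only [Fin.addCases_right]
    exact (app_mvar _ _ _ _).trans (app_nil _ _)

/-! ### Abstraction -/

/-- Induction on `m`, abstracting the first `m` variables over `C × (0)` and then the last one by
the exponential. An arbitrary extension `D` is allowed because `D` stays fixed while its base grows
from `C` to `C × (0)`; with `ext` alone the lists would not match. -/
theorem exists_unique_lam {m : ℕ} {C D : T.Carrier} {w : D ⟶ C} {v : Fin m → (D ⟶ T.of [0])}
    (hD : IsExtension w v) (b : D ⟶ T.of [0]) : ∃! a : C ⟶ T.of [m], app (w ≫ a) v = b := by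
  induction m generalizing C with
  | zero =>
    -- An extension by no variables is an isomorphism, and `u` is the inverse of `w`.
    obtain ⟨u, ⟨hu, -⟩, -⟩ := hD C (𝟙 C) fun j => j.elim0
    have hu' : w ≫ u = 𝟙 D := (hD D w v).unique ⟨by rw [Category.assoc, hu, Category.comp_id],
      fun j => j.elim0⟩ ⟨Category.id_comp _, fun j => j.elim0⟩
    refine ⟨u ≫ b, ?_, fun a ha => ?_⟩
    · simp only [app_nil, ← Category.assoc, hu', Category.id_comp]
    · rw [← ha]
      simp only [app_nil, ← Category.assoc, hu, Category.id_comp]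
  | succ m ih =>
    -- The last variable is moved into the base, so that `w'` exhibits `D` as an extension of `C ×
    -- (0)` by the remaining `m` variables.
    obtain ⟨w', ⟨h₁, h₂⟩, -⟩ := exists_unique_append w (v (Fin.natAdd m (0 : Fin 1)))
    have hD' : IsExtension w' fun j => v (Fin.castAdd 1 j) := by
      intro E a c
      obtain ⟨h, ⟨hw, hv⟩, hu⟩ := hD E (a ≫ T.els (EqTheory.fst C [0]))
        (Fin.addCases (m := m) (n := 1) c fun _ => a ≫ T.els (EqTheory.snd C [0]))
      refine ⟨h, ⟨?_, fun j => ?_⟩, fun k hk => hu k ⟨?_, fun j => ?_⟩⟩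
      · refine (exists_unique_append _ _).unique ⟨?_, ?_⟩ ⟨rfl, rfl⟩
        · rw [Category.assoc, h₁, hw]
        · rw [Category.assoc, h₂, hv, Fin.addCases_right]
      · rw [hv, Fin.addCases_left]
      · rw [← h₁, ← Category.assoc, hk.1]
      · induction j using Fin.addCases with
        | left j => rw [Fin.addCases_left, hk.2]
        | right j =>
          rw [Fin.addCases_right, Subsingleton.elim j 0, ← h₂, ← Category.assoc, hk.1]
    have key : ∀ (a : C ⟶ T.of [m + 1])
        (e : T.of (HAppend.hAppend (α := List ℕ) C [0]) ⟶ T.of ([m + 1] ++ [0])),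
        e ≫ T.els (EqTheory.fst [m + 1] [0]) = T.els (EqTheory.fst C [0]) ≫ a →
        e ≫ T.els (EqTheory.snd [m + 1] [0]) = T.els (EqTheory.snd C [0]) →
        app (w' ≫ e ≫ T.els (EqTheory.ev [m])) (fun j => v (Fin.castAdd 1 j)) = app (w ≫ a) v := by
      intro a e h₃ h₄
      have h := app_ev (w' ≫ e) fun j => v (Fin.castAdd 1 j)
      rw [Category.assoc, Category.assoc, Category.assoc] at h
      rw [h, h₃, h₄, h₂, ← Category.assoc, h₁]
      congr 1
      refine Term.addCases_ext (fun x => ?_) (fun x => ?_)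
      · rw [Fin.addCases_left]
      · rw [Fin.addCases_right, Subsingleton.elim x 0]
    -- `a'` abstracts the first `m` variables over `C × (0)`, and its mate `a` abstracts the last
    -- one. Uniqueness of the two steps combines.
    obtain ⟨a', ha', hu'⟩ := ih hD'
    obtain ⟨a, ha, hu⟩ := T.exists_unique_mate C [m] a'
    have hl : ∀ a : C ⟶ T.of [m + 1], app (w' ≫
        ((T.isProduct [m + 1] [0]).lift (BinaryFan.mk
          (P := T.of (HAppend.hAppend (α := List ℕ) C [0]))
          (T.functor.map (EqTheory.fst C [0]) ≫ a) (T.functor.map (EqTheory.snd C [0]))) ≫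
        T.functor.map (EqTheory.ev [m]))) (fun j => v (Fin.castAdd 1 j)) = app (w ≫ a) v :=
      fun a => key a _ ((T.isProduct [m + 1] [0]).fac _ ⟨.left⟩)
        ((T.isProduct [m + 1] [0]).fac _ ⟨.right⟩)
    refine ⟨a, ?_, fun c hc => hu c (hu' _ ((hl c).trans hc))⟩
    refine (hl a).symm.trans ?_
    refine Eq.trans ?_ ha'
    congr 2

/-- Abstraction of `m` arguments, the inverse of application. -/
noncomputable def lam {m : ℕ} {C : T.Carrier} (b : ext C m ⟶ T.of [0]) : C ⟶ T.of [m] :=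
  (exists_unique_lam (isExtension_ext C m) b).choose

theorem app_lam {m : ℕ} {C : T.Carrier} (b : ext C m ⟶ T.of [0]) :
    app (wk C m ≫ lam b) (vr C) = b :=
  (exists_unique_lam (isExtension_ext C m) b).choose_spec.1

/-- Extensionality: morphisms into `(m)` are determined by their application to fresh variables. -/
theorem hom_ext_app {m : ℕ} {C : T.Carrier} {a a' : C ⟶ T.of [m]}
    (h : app (wk C m ≫ a) (vr C) = app (wk C m ≫ a') (vr C)) : a = a' :=
  (exists_unique_lam (isExtension_ext C m) _).unique h rfl

theorem lam_app {m : ℕ} {C : T.Carrier} (a : C ⟶ T.of [m]) :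
    lam (app (wk C m ≫ a) (vr C)) = a :=
  hom_ext_app (app_lam _)

/-- The β-rule at an arbitrary stage, obtained by pulling `app_lam` back along the pairing of `h`
and `c`. -/
theorem app_comp_lam {m : ℕ} {C D : T.Carrier} (h : D ⟶ C) (b : ext C m ⟶ T.of [0])
    (c : Fin m → (D ⟶ T.of [0])) : app (h ≫ lam b) c = pair h c ≫ b := by
  conv_rhs => rw [← app_lam b]
  simp only [comp_app, pair_vr, ← Category.assoc, pair_wk]

/-- The action of `- × (0)ᵐ` on morphisms. -/
noncomputable def extMap {C D : T.Carrier} (h : D ⟶ C) (m : ℕ) : ext D m ⟶ ext C m :=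
  pair (wk D m ≫ h) (vr D)

theorem comp_lam {m : ℕ} {C D : T.Carrier} (h : D ⟶ C) (b : ext C m ⟶ T.of [0]) :
    h ≫ lam b = lam (extMap h m ≫ b) := by
  apply hom_ext_app
  rw [app_lam, ← Category.assoc, app_comp_lam, extMap]


/-! ### Interpretation of the internal language -/

/-- Extension of a variable environment to `k` bound variables. -/
def extEnv {n : ℕ} {C : T.Carrier} (σ : Fin n → (C ⟶ T.of [0])) (k : ℕ) :
    Fin (n + k) → (ext C k ⟶ T.of [0]) :=
  Fin.addCases (fun x => wk C k ≫ σ x) (vr C)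

/-- The interpretation of an operator of the internal language. -/
noncomputable def opApp {C : T.Carrier} (ω : T.internalSignature.Op)
    (a : ∀ m, Position m (T.internalSignature.arity ω) → (C ⟶ T.of [m])) : C ⟶ T.of [0] :=
  app (tuple (fun m i => a m (Position.inl (List.replicate ω.2.1 0) i)) ≫ ω.2.2)
    fun j => a 0 (Position.inr ω.1 (Position.ofFin j))

theorem comp_opApp {C D : T.Carrier} (h : D ⟶ C) (ω : T.internalSignature.Op)
    (a : ∀ m, Position m (T.internalSignature.arity ω) → (C ⟶ T.of [m])) :
    h ≫ opApp ω a = opApp ω fun m i => h ≫ a m i := by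
  rw [opApp, comp_app, ← Category.assoc, comp_tuple, opApp]

/-- The interpretation of a term in an environment. -/
noncomputable def eval {Θ : List ℕ} {n : ℕ} : Term T.internalSignature Θ n → (C : T.Carrier) →
    (∀ m, Position m Θ → (C ⟶ T.of [m])) → (Fin n → (C ⟶ T.of [0])) → (C ⟶ T.of [0])
  | .var x, _, _, σ => σ x
  | .mvar (m := m) i t, C, ρ, σ => app (ρ m i) fun j => eval (t j) C ρ σ
  | .op ω t, C, ρ, σ => opApp ω fun m i =>
      lam (eval (t m i) (ext C m) (fun k p => wk C m ≫ ρ k p) (extEnv σ m))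

variable {Θ Θ' : List ℕ} {C D : T.Carrier} {n n' : ℕ}

theorem extMap_wk (h : D ⟶ C) (m : ℕ) : extMap h m ≫ wk C m = wk D m ≫ h := pair_wk _ _

theorem extMap_vr (h : D ⟶ C) {m : ℕ} (j : Fin m) : extMap h m ≫ vr C j = vr D j := pair_vr _ _ _

theorem extMap_wk_assoc {X : T.Carrier} (h : D ⟶ C) (m : ℕ) (f : C ⟶ X) :
    extMap h m ≫ wk C m ≫ f = wk D m ≫ h ≫ f := by
  rw [← Category.assoc, extMap_wk, Category.assoc]

theorem pair_wk_assoc {m : ℕ} {X : T.Carrier} (a : D ⟶ C) (b : Fin m → (D ⟶ T.of [0]))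
    (f : C ⟶ X) : pair a b ≫ wk C m ≫ f = a ≫ f := by
  rw [← Category.assoc, pair_wk]

theorem extMap_extEnv (h : D ⟶ C) (σ : Fin n → (C ⟶ T.of [0])) (k : ℕ) :
    (fun x => extMap h k ≫ extEnv σ k x) = extEnv (fun x => h ≫ σ x) k :=
  Term.addCases_ext (fun x => by simp [extEnv, extMap_wk_assoc])
    (fun x => by simp [extEnv, extMap_vr])

/-- Evaluation is stable under change of stage, because application, abstraction and tupling all
are. -/
theorem comp_eval (t : Term T.internalSignature Θ n) (h : D ⟶ C)
    (ρ : ∀ m, Position m Θ → (C ⟶ T.of [m])) (σ : Fin n → (C ⟶ T.of [0])) :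
    h ≫ eval t C ρ σ = eval t D (fun m i => h ≫ ρ m i) (fun x => h ≫ σ x) := by
  induction t generalizing C D with
  | var x => rfl
  | mvar i t ih => simp only [eval, comp_app, ih]
  | op ω t ih =>
    simp only [eval, comp_opApp, comp_lam, ih, extMap_extEnv, extMap_wk_assoc]

theorem extEnv_liftRen (r : Fin n → Fin n') (σ : Fin n' → (C ⟶ T.of [0])) (k : ℕ) :
    (fun x => extEnv σ k (liftRen r k x)) = extEnv (fun x => σ (r x)) k :=
  Term.addCases_ext (fun x => by simp [extEnv, liftRen]) (fun x => by simp [extEnv, liftRen])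

theorem eval_rename (t : Term T.internalSignature Θ n) (r : Fin n → Fin n')
    (ρ : ∀ m, Position m Θ → (C ⟶ T.of [m])) (σ : Fin n' → (C ⟶ T.of [0])) :
    eval (t.rename r) C ρ σ = eval t C ρ fun x => σ (r x) := by
  induction t generalizing n' C with
  | var x => rfl
  | mvar i t ih => simp only [Term.rename, eval, ih]
  | op ω t ih => simp only [Term.rename, eval, ih, extEnv_liftRen]

theorem eval_liftSub (s : Fin n → Term T.internalSignature Θ n')
    (ρ : ∀ m, Position m Θ → (C ⟶ T.of [m])) (σ : Fin n' → (C ⟶ T.of [0])) (k : ℕ) :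
    (fun x => eval (Term.liftSub s k x) (ext C k) (fun m i => wk C k ≫ ρ m i) (extEnv σ k)) =
      extEnv (fun x => eval (s x) C ρ σ) k :=
  Term.addCases_ext
    (fun x => by simp [Term.liftSub_castAdd, eval_rename, extEnv, comp_eval])
    (fun x => by simp [Term.liftSub_natAdd, extEnv, eval])

theorem eval_subst (t : Term T.internalSignature Θ n) (s : Fin n → Term T.internalSignature Θ n')
    (ρ : ∀ m, Position m Θ → (C ⟶ T.of [m])) (σ : Fin n' → (C ⟶ T.of [0])) :
    eval (t.subst s) C ρ σ = eval t C ρ fun x => eval (s x) C ρ σ := by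
  induction t generalizing n' C with
  | var x => rfl
  | mvar i t ih => simp only [Term.subst, eval, ih]
  | op ω t ih => simp only [Term.subst, eval, ih, eval_liftSub]

/-- The interpretation of a metasubstitution. -/
theorem eval_msubst (t : Term T.internalSignature Θ n)
    (τ : ∀ m, Position m Θ → Term T.internalSignature Θ' (n + m))
    (ρ : ∀ m, Position m Θ' → (C ⟶ T.of [m])) (σ : Fin n → (C ⟶ T.of [0])) :
    eval (t.msubst τ) C ρ σ = eval t C (fun m i => lam (eval (τ m i) (ext C m)
      (fun k p => wk C m ≫ ρ k p) (extEnv σ m))) σ := by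
  induction t generalizing C with
  | var x => rfl
  | mvar i t ih =>
    simp only [Term.msubst, eval_subst, eval, ← ih]
    -- The metavariable is now bound to an abstraction, so its application β-reduces; the identity
    -- is inserted to match the shape of `app_comp_lam`.
    conv_rhs => rw [← Category.id_comp (lam _), app_comp_lam, comp_eval]
    simp only [pair_wk_assoc, Category.id_comp]
    congr 1
    exact Term.addCases_ext (fun x => by simp [extEnv, eval, pair_wk_assoc])
      (fun x => by simp [extEnv, pair_vr])
  | op ω t ih =>
    -- Under a binder the substituted terms are weakened, and this agrees with weakening their
    -- abstractions by naturality of `lam`.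
    have h : ∀ k m (i : Position m Θ), lam (eval ((τ m i).rename (liftRen (Fin.castAdd k) m))
        (ext (ext C k) m) (fun l p => wk (ext C k) m ≫ wk C k ≫ ρ l p) (extEnv (extEnv σ k) m)) =
        wk C k ≫ lam (eval (τ m i) (ext C m) (fun l p => wk C m ≫ ρ l p) (extEnv σ m)) := by
      intro k m i
      rw [comp_lam, comp_eval, eval_rename, extMap_extEnv, extEnv_liftRen]
      simp only [extMap_wk_assoc, extEnv, Fin.addCases_left]
    simp only [Term.msubst, eval, ih, h]

theorem eval_inst (t : Term T.internalSignature Θ n)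
    (s : ∀ m, Position m Θ → Term T.internalSignature Θ' m)
    (ρ : ∀ m, Position m Θ' → (C ⟶ T.of [m])) (σ : Fin n → (C ⟶ T.of [0])) :
    eval (t.inst s) C ρ σ = eval t C (fun m i => lam (eval (s m i) (ext C m)
      (fun k p => wk C m ≫ ρ k p) (vr C))) σ := by
  simp only [Term.inst, eval_msubst, eval_rename, extEnv, Fin.addCases_right]

/-- The argument `(x⃗ᵢ) Mᵢ[x⃗ᵢ]` evaluates to the η-expansion of `ρ` at `Mᵢ`, which `lam_app`
contracts. -/
theorem eval_opTerm (f : T.of Θ ⟶ T.of [n]) (ρ : ∀ m, Position m Θ → (C ⟶ T.of [m]))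
    (σ : Fin n → (C ⟶ T.of [0])) : eval (opTerm f) C ρ σ = app (tuple ρ ≫ f) σ := by
  simp only [opTerm, eval, opApp, Position.elim_inl, Position.elim_inr, extEnv, Fin.addCases_right,
    Fin.addCases_left, lam_app, Position.index_ofFin]
  congr 1
  funext j
  -- The last `n` arguments bind nothing, so their abstraction is over zero variables and only
  -- undoes a trivial weakening.
  refine hom_ext_app ?_
  rw [app_lam, app_nil]

theorem eval_ofElementary (s : Term emptySignature Θ n) (ρ : ∀ m, Position m Θ → (C ⟶ T.of [m]))
    (σ : Fin n → (C ⟶ T.of [0])) : eval s.ofElementary C ρ σ = app (tuple ρ ≫ T.el s) σ := by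
  induction s with
  | var x => exact (app_var _ _ _).symm
  | mvar i t ih =>
    rw [app_mvar, tuple_pr]
    simp only [← ih]
    rfl
  | op ω t ih => exact nomatch ω

/-- The interpretation is sound. -/
theorem eval_eq_of_derivable {s t : Term T.internalLanguage.sig Θ n}
    (h : T.internalLanguage.Derivable s t) : ∀ (C : T.Carrier)
    (ρ : ∀ m, Position m Θ → (C ⟶ T.of [m])) (σ : Fin n → (C ⟶ T.of [0])),
    eval s C ρ σ = eval t C ρ σ := by
  induction h with
  | ax h =>
    intro C ρ σ
    change InternalEquation _ _ at h
    cases h with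
    | e1 s => exact (eval_ofElementary _ _ _).trans (eval_opTerm _ _ _).symm
    | e2 h g f φ hφ hh =>
      rw [eval_inst, eval_opTerm, eval_opTerm]
      simp only [eval_opTerm, ← comp_tuple, Category.assoc, lam_app]
      rw [hh, ← Category.assoc, ← Category.assoc]
      -- After η-contraction, (E2) reduces to the fact that `φ` is the tuple of the `fᵢ`, checked on
      -- projections.
      refine congrArg (fun k => app (k ≫ g) σ) (hom_ext fun m i => ?_)
      rw [Category.assoc, Category.assoc, tuple_pr]
      exact congrArg (tuple ρ ≫ ·) (hφ m i)
  | refl t => exact fun _ _ _ => rfl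
  | symm _ ih => exact fun C ρ σ => (ih C ρ σ).symm
  | trans _ _ ih₁ ih₂ => exact fun C ρ σ => (ih₁ C ρ σ).trans (ih₂ C ρ σ)
  | msubst _ _ ih₁ ih₂ =>
    intro C ρ σ
    refine (eval_msubst _ _ _ _).trans (Eq.trans ?_ (eval_msubst _ _ _ _).symm)
    refine (eval_rename _ _ _ _).trans (Eq.trans ?_ (eval_rename _ _ _ _).symm)
    refine (ih₁ _ _ _).trans ?_
    congr 1
    funext m i
    congr 1
    refine (eval_rename _ _ _ _).trans (Eq.trans ?_ (eval_rename _ _ _ _).symm)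
    exact ih₂ _ _ _ _ _

/-- The internal language proves only equations that hold in the theory. -/
theorem eq_of_derivable_opTerm {f g : T.of Θ ⟶ T.of [n]}
    (h : T.internalLanguage.Derivable (opTerm f) (opTerm g)) : f = g := by
  refine hom_ext_app ?_
  have h' := eval_eq_of_derivable h (ext (T.of Θ) n) (fun _ i => wk (T.of Θ) n ≫ T.pr i)
    (vr (T.of Θ))
  rwa [eval_opTerm, eval_opTerm, ← comp_tuple, show tuple (fun _ i => T.pr i) = 𝟙 (T.of Θ) from
    hom_ext fun _ _ => (tuple_pr _ _).trans (Category.id_comp _).symm, Category.comp_id] at h'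

end Theory
end SecondOrder

namespace SecondOrder

theorem Term.rename_eq_subst {S : Signature.{v}} {Θ : List ℕ} {n n' : ℕ} (t : Term S Θ n)
    (ρ : Fin n → Fin n') : t.rename ρ = t.subst fun x => .var (ρ x) := by
  rw [← Term.subst_var (t.rename ρ), Term.subst_rename]
  rfl

namespace Theory
variable {T : Theory.{v}} {Θ Θ' : List ℕ} {n n' : ℕ}

/-! ### Terms of the internal language are represented by morphisms -/

/-- The internal language proves `t ≡ t_f`. -/
def Represents (f : T.of Θ ⟶ T.of [n]) (t : Term T.internalSignature Θ n) : Prop :=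
  T.internalLanguage.Derivable t (opTerm f)

theorem represents_opTerm (f : T.of Θ ⟶ T.of [n]) : Represents f (opTerm f) :=
  Presentation.Derivable.refl _

theorem represents_ofElementary (s : Term emptySignature Θ n) :
    Represents (T.el s) s.ofElementary :=
  Presentation.Derivable.ax (InternalEquation.e1 s)

/-- Congruence of metasubstitution moves everything to terms `t_f`, where (E2) read backwards
applies. -/
theorem Represents.inst {g : T.of Θ' ⟶ T.of [n]} {t : Term T.internalSignature Θ' n}
    (hg : Represents g t) (φ : T.of Θ ⟶ T.of Θ')
    {s : ∀ m, Position m Θ' → Term T.internalSignature Θ m}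
    (hs : ∀ m i, Represents (φ ≫ T.pr i) (s m i)) : Represents (φ ≫ g) (t.inst s) :=
  (Presentation.Derivable.inst hg hs).trans
    (Presentation.Derivable.ax (InternalEquation.e2 _ g _ φ (fun _ _ => rfl) rfl)).symm

/-- A term is representable if it is provably equal to `t_f` for some morphism `f`. -/
def Representable (t : Term T.internalSignature Θ n) : Prop :=
  ∃ f : T.of Θ ⟶ T.of [n], Represents f t

theorem Representable.inst {t : Term T.internalSignature Θ' n} (ht : Representable t)
    {s : ∀ m, Position m Θ' → Term T.internalSignature Θ m}
    (hs : ∀ m i, Representable (s m i)) : Representable (t.inst s) := by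
  obtain ⟨g, hg⟩ := ht
  choose f hf using hs
  exact ⟨tuple f ≫ g, hg.inst _ fun m i => by rw [tuple_pr]; exact hf m i⟩

/-- Substitution for variables is a special metasubstitution: put `t` for `M` and `σⱼ` for `Nⱼ` in
the elementary term `M[N₁[x⃗], …, Nₙ[x⃗]]`. -/
theorem Representable.subst {t : Term T.internalSignature Θ n} (ht : Representable t)
    {σ : Fin n → Term T.internalSignature Θ n'} (hσ : ∀ x, Representable (σ x)) :
    Representable (t.subst σ) := by
  have h := Representable.inst ⟨_, represents_ofElementary (T := T)
    (.mvar (.head : Position n (n :: List.replicate n n'))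
      fun j => .mvar (.tail (.ofFin j)) .var)⟩
      (s := Position.cases t (Position.replicateCases (α := fun m => Term _ Θ m) σ)) (by
        intro m i
        cases i with
        | head => exact ht
        | tail i =>
          refine Position.forall_replicate (P := fun m i => Representable
            (Position.replicateCases (α := fun m => Term _ Θ m) σ m i)) (fun j => ?_) m i
          rw [Position.replicateCases_ofFin]
          exact hσ j)
  rw [Term.ofElementary, Term.inst_mvar] at h
  convert h using 2
  · funext j
    rw [Term.ofElementary, Term.inst_mvar]
    refine (Eq.trans (Term.subst_var _) ?_).symm
    exact Position.replicateCases_ofFin (α := fun m => Term _ Θ m) σ j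
  · rfl

theorem representable_var (x : Fin n) :
    Representable (.var x : Term T.internalSignature Θ n) :=
  ⟨_, represents_ofElementary (.var x)⟩

theorem representable_mvar {m : ℕ} (i : Position m Θ) {t : Fin m → Term T.internalSignature Θ n}
    (ht : ∀ j, Representable (t j)) : Representable (.mvar i t) :=
  Representable.subst ⟨_, represents_ofElementary (.mvar i .var)⟩ ht

theorem Representable.rename {t : Term T.internalSignature Θ n} (ht : Representable t)
    (ρ : Fin n → Fin n') : Representable (t.rename ρ) := by
  rw [Term.rename_eq_subst]
  exact ht.subst fun _ => representable_var _

theorem representable_liftSub {σ : Fin n → Term T.internalSignature Θ n'}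
    (hσ : ∀ x, Representable (σ x)) (k : ℕ) (x : Fin (n + k)) :
    Representable (Term.liftSub σ k x) := by
  induction x using Fin.addCases with
  | left x => rw [Term.liftSub_castAdd]; exact (hσ x).rename _
  | right x => rw [Term.liftSub_natAdd]; exact representable_var _

theorem representable_paramSub (Θ : List ℕ) (n : ℕ) (x : Fin (n + 1)) :
    Representable (paramSub Θ n x : Term T.internalSignature _ _) := by
  induction x using Fin.addCases with
  | left x => rw [paramSub, Fin.addCases_left]; exact representable_var _
  | right x => rw [paramSub, Fin.addCases_right]; exact representable_mvar _ fun j => j.elim0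

/-- If `g` represents `param t`, its exponential transpose `g'` represents `t`. Indeed `param` of
`t_{g'}` is the evaluation term instantiated at `t_{g'}` and the last metavariable, hence is
represented by `g` as well. Derivability is closed under `unparam`, which inverts `param`. -/
theorem representable_of_param {t : Term T.internalSignature Θ (n + 1)}
    (ht : Representable (param t)) : Representable t := by
  obtain ⟨g, hg⟩ := ht
  obtain ⟨g', hg', -⟩ := T.exists_unique_mate Θ [n] g
  set e := (T.isProduct [n + 1] [0]).lift (BinaryFan.mk (P := T.of (Θ ++ [0]))
    (T.functor.map (EqTheory.fst Θ [0]) ≫ g') (T.functor.map (EqTheory.snd Θ [0])))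
  have he₁ : e ≫ T.els (EqTheory.fst [n + 1] [0]) = T.els (EqTheory.fst Θ [0]) ≫ g' :=
    (T.isProduct [n + 1] [0]).fac _ ⟨.left⟩
  have he₂ : e ≫ T.els (EqTheory.snd [n + 1] [0]) = T.els (EqTheory.snd Θ [0]) :=
    (T.isProduct [n + 1] [0]).fac _ ⟨.right⟩
  have h₁ : EqTheory.fst [n + 1] [0] = EqTheory.proj (.head : Position (n + 1) [n + 1, 0]) :=
    (EqTheory.single_eta _).symm
  have h₂ : EqTheory.snd [n + 1] [0] = EqTheory.proj (.tail .head : Position 0 [n + 1, 0]) :=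
    (EqTheory.single_eta _).symm
  have h₃ : EqTheory.snd Θ [0] = EqTheory.proj (Position.inr Θ .head) :=
    (EqTheory.single_eta _).symm
  rw [h₁] at he₁
  rw [h₂, h₃] at he₂
  have hw := (represents_opTerm g').inst (T.els (EqTheory.fst Θ [0]))
    (s := fun _ p => .mvar (p.inl [0]) .var) fun m i => by
      rw [els_comp_pr]
      exact represents_ofElementary (.mvar (i.inl [0]) .var)
  let w : ∀ m, Position m [n + 1, 0] → Term T.internalSignature (Θ ++ [0]) m :=
    Position.cases ((opTerm g').inst fun _ p => .mvar (p.inl [0]) .var)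
      (Position.cases (.mvar (Position.inr Θ .head) .var) fun _ p => nomatch p)
  -- The components of `e` are the weakened `g'` and the last projection, represented by the two
  -- entries of `w`.
  have key := (represents_ofElementary (T := T) (EqTheory.ev [n] n .head)).inst e (s := w) (by
        intro m i
        cases i with
        | head => exact he₁ ▸ hw
        | tail i =>
          cases i with
          | head => exact he₂ ▸ represents_ofElementary (.mvar (Position.inr Θ .head) .var)
          | tail i => exact nomatch i)
  rw [show e ≫ T.el (EqTheory.ev [n] n .head) = g from
    (congrArg (e ≫ T.els ·) (EqTheory.single_eta _)).trans hg'] at key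
  refine ⟨g', ?_⟩
  have hp : param (opTerm g') = (EqTheory.ev [n] n .head).ofElementary.inst w := by
    rw [EqTheory.ev, Term.ofElementary]
    refine Eq.trans ?_ (Term.inst_mvar _ _ _).symm
    rw [param]
    refine congrArg₂ Term.subst (Term.addCases_ext (fun x => ?_) fun x => ?_) rfl
    · rw [paramSub, Fin.addCases_left, Fin.addCases_left]
      rfl
    · rw [paramSub, Fin.addCases_right, Fin.addCases_right]
      refine Eq.trans ?_ (Term.inst_mvar _ _ _).symm
      exact congrArg (Term.mvar _) (Subsingleton.elim _ _)
  rw [← hp] at key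
  exact cast (congrArg₂ (fun a b : Term T.internalSignature Θ (n + 1) =>
    T.internalLanguage.Derivable a b) (unparam_param t) (unparam_param (opTerm g')))
    (Presentation.Derivable.trans hg (Presentation.Derivable.symm key)).unparam

/-- With no ambient variables, the binding arguments of the operator have no parameters and can be
plugged in by `inst`; its nullary arguments are then substituted for the variables of `t_f`. -/
theorem op_eq_opTerm_inst_subst (f : T.of Θ' ⟶ T.of [n'])
    (t : ∀ m, Position m (Θ' ++ List.replicate n' 0) → Term T.internalSignature Θ (0 + m)) :
    (.op ⟨Θ', n', f⟩ t : Term T.internalSignature Θ 0) =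
      ((opTerm f).inst fun m i => (t m (Position.inl (List.replicate n' 0) i)).rename
        (Fin.cast (Nat.zero_add m))).subst
      fun j => t 0 (Position.inr Θ' (Position.ofFin j)) := by
  refine Eq.trans ?_ (congrArg (Term.subst _) (Term.inst_op _ _ _)).symm
  refine congrArg (Term.op _) (funext fun m => funext fun i => ?_)
  rcases Position.inl_or_inr i with ⟨q, rfl⟩ | ⟨q, rfl⟩
  · refine Eq.trans ?_ (congrArg (fun u => Term.subst _ (Term.inst u _))
      (Position.elim_inl _ _ q)).symm
    rw [Term.inst_mvar, Term.subst_rename, Term.subst_subst]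
    refine (Term.subst_var _).symm.trans ?_
    congr 1
    funext x
    simp only [Function.comp, Term.inst_var, Term.subst, Term.liftSub_natAdd]
    congr 1
    ext
    simp
  · refine Eq.trans ?_ (congrArg (fun u => Term.subst _ (Term.inst u _))
      (Position.elim_inr _ _ q)).symm
    rw [Term.inst_var]
    -- All entries here are `0`, so the remaining renaming is along `Fin.castAdd 0`, the identity.
    revert m q
    refine Position.forall_replicate fun j => ?_
    rw [Position.index_ofFin, Term.subst, Term.liftSub_castAdd]
    exact (Term.rename_id _).symm

/-- Induction on the number of free variables: `param` commutes with the operator and turns one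
variable into a nullary metavariable, so `Θ` has to vary. -/
theorem representable_op (ω : T.internalSignature.Op)
    (t : ∀ m, Position m (T.internalSignature.arity ω) → Term T.internalSignature Θ (n + m))
    (ht : ∀ m i, Representable (t m i)) : Representable (.op ω t) := by
  induction n generalizing Θ with
  | zero =>
    obtain ⟨Ξ, k, f⟩ := ω
    refine (op_eq_opTerm_inst_subst f t).symm ▸ ?_
    exact Representable.subst (Representable.inst ⟨f, represents_opTerm f⟩
      fun m i => (ht _ _).rename _) fun j => ht _ _
  | succ n ih =>
    refine representable_of_param ?_
    rw [param, Term.inst_op, Term.subst]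
    exact ih _ fun m i => ((ht m i).inst fun _ p => representable_mvar _ fun _ =>
      representable_var _).subst (representable_liftSub (representable_paramSub _ _) m)

theorem representable (t : Term T.internalSignature Θ n) : Representable t := by
  induction t with
  | var x => exact representable_var x
  | mvar i t ih => exact representable_mvar i ih
  | op ω t ih => exact representable_op ω t ih

/-! ### The comparison isomorphism -/

open Presentation

theorem cls_eq_cls_opTerm {f : T.of Θ ⟶ T.of [n]} {t : Term T.internalSignature Θ n}
    (h : Represents f t) :
    cls (E := T.internalLanguage) t = cls (opTerm f) := cls_eq_cls.2 h

variable (T)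

/-- The comparison functor from a theory to the classifying theory of its internal language. -/
noncomputable def toClassifying : T.Carrier ⥤ T.internalLanguage.theory.Carrier where
  obj Θ := Θ
  map {Θ Θ'} f := (fun _ p => cls (opTerm (f ≫ T.pr p)) : T.internalLanguage.ClassTuple Θ Θ')
  map_id Θ := by
    funext n p
    refine (cls_eq_cls_opTerm ?_).symm
    rw [Category.id_comp]
    exact represents_ofElementary (.mvar p .var)
  map_comp {Θ Θ' Θ''} f g := by
    refine Eq.trans ?_ (compTuple_cls (E := T.internalLanguage) _ _).symm
    funext n q
    rw [Category.assoc]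
    exact (cls_eq_cls_opTerm ((represents_opTerm _).inst f fun _ _ => represents_opTerm _)).symm

theorem functor_comp_toClassifying :
    T.functor ⋙ T.toClassifying = T.internalLanguage.theory.functor := by
  refine CategoryTheory.Functor.hext (fun _ => rfl) fun Θ Θ' s => heq_of_eq ?_
  funext n p
  refine (cls_eq_cls_opTerm ?_).symm
  exact Eq.subst (motive := fun f => Represents f _) (els_comp_pr s p).symm
    (represents_ofElementary (s n p))

/-- Injectivity is soundness tested on projections; surjectivity is representability of each
component, followed by tupling. -/
theorem toClassifying_map_bijective (Θ Θ' : T.Carrier) :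
    Function.Bijective (T.toClassifying.map : (Θ ⟶ Θ') → _) := by
  refine ⟨fun f g h => hom_ext fun m i => eq_of_derivable_opTerm
    (cls_eq_cls.1 (congrFun (congrFun h m) i)), fun s => ?_⟩
  obtain ⟨s, rfl⟩ := exists_tuple (E := T.internalLanguage) s
  choose f hf using fun m (i : Position m Θ') => representable (s m i)
  refine ⟨tuple f, ?_⟩
  funext m i
  refine (cls_eq_cls_opTerm ?_).symm
  exact (tuple_pr f i).symm ▸ hf m i

/-- The inverse of the comparison functor. -/
noncomputable def ofClassifying : T.internalLanguage.theory.Carrier ⥤ T.Carrier where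
  obj Θ := Θ
  map {Θ Θ'} s := (Equiv.ofBijective _ (T.toClassifying_map_bijective Θ Θ')).symm s
  map_id Θ := (Equiv.symm_apply_eq _).2 (T.toClassifying.map_id Θ).symm
  map_comp s t := (Equiv.symm_apply_eq _).2 (by
    refine Eq.trans ?_ (T.toClassifying.map_comp _ _).symm
    congr 1
    · exact (Equiv.apply_symm_apply (Equiv.ofBijective _ (T.toClassifying_map_bijective _ _)) s).symm
    · exact (Equiv.apply_symm_apply (Equiv.ofBijective _ (T.toClassifying_map_bijective _ _)) t).symm)

theorem toClassifying_comp_ofClassifying :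
    T.toClassifying ⋙ T.ofClassifying = 𝟭 T.Carrier := by
  refine CategoryTheory.Functor.hext (fun _ => rfl) fun Θ Θ' f => heq_of_eq ?_
  exact Equiv.symm_apply_apply (Equiv.ofBijective _ (T.toClassifying_map_bijective Θ Θ')) f

theorem ofClassifying_comp_toClassifying :
    T.ofClassifying ⋙ T.toClassifying = 𝟭 T.internalLanguage.theory.Carrier := by
  refine CategoryTheory.Functor.hext (fun _ => rfl) fun Θ Θ' f => heq_of_eq ?_
  exact Equiv.apply_symm_apply (Equiv.ofBijective _ (T.toClassifying_map_bijective Θ Θ')) f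

/-- The comparison functor as an equivalence of categories. -/
noncomputable def classifyingEquivalence : T.Carrier ≌ T.internalLanguage.theory.Carrier :=
  CategoryTheory.Equivalence.mk T.toClassifying T.ofClassifying
    (eqToIso T.toClassifying_comp_ofClassifying.symm)
    (eqToIso T.ofClassifying_comp_toClassifying)

/-- A theory is isomorphic to the classifying theory of its internal language. -/
noncomputable def classifyingIso : T ≅ T.internalLanguage.theory where
  hom := ⟨T.toClassifying,
    inferInstanceAs (PreservesFiniteProducts T.classifyingEquivalence.functor),
    T.functor_comp_toClassifying⟩
  inv := ⟨T.ofClassifying,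
    inferInstanceAs (PreservesFiniteProducts T.classifyingEquivalence.inverse), by
      rw [← T.functor_comp_toClassifying, Functor.assoc, T.toClassifying_comp_ofClassifying,
        Functor.comp_id]⟩
  hom_inv_id := Translation.ext T.toClassifying_comp_ofClassifying
  inv_hom_id := Translation.ext T.ofClassifying_comp_toClassifying

end Theory
end SecondOrder

/-- Every second-order algebraic theory is isomorphic, in the category of second-order algebraic
theories and algebraic translations, to the theory of its internal language. -/
theorem theorem5p5 (T : SecondOrder.Theory.{v}) :
    Nonempty (T ≅ T.internalLanguage.theory) :=
  ⟨T.classifyingIso⟩
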